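/- Let $R$ be a commutative ring, $\mathscr{C}$ an (essentially) small additive $R$-linear category and $(\mathscr{C},\mathbb{E},\mathfrak{s})$ an $R$-linear extriangulated category in the sense of Nakaoka and Palu. Put $\mathbb{E}^0=\mathrm{Hom}_{\mathscr{C}}$, $\mathbb{E}^1=\mathbb{E}$ and, for $n\ge 1$, $\mathbb{E}^{n+1}(X,Y)=\int^{M\in\mathscr{C}}\mathbb{E}^{n}(M,Y)\otimes_R\mathbb{E}(X,M)$. For $n\ge 0$ let $\mathbb{E}_{\mathrm I}^{-n}(X,Y)$ be the $R$-module of natural transformations $\mathbb{E}^n(Y,-)\to\mathscr{C}(X,-)$, and $\mathbb{E}_{\mathrm{II}}^{-n}(X,Y)$ the $R$-module of natural transformations $\mathbb{E}^n(-,X)\to\mathscr{C}(-,Y)$, between functors with values in $R$-modules. A morphism $f$ is called projective if $\mathbb{E}(f,-)=0$ and injective if $\mathbb{E}(-,f)=0$. The category has enough projective (injective) morphisms if every object is the target of a projective deflation (the source of an injective inflation). An object $P$ is projective if morphisms from $P$ lift along deflations, and there are enough projective objects if every object is the target of a deflation from a projective object; injective objects are defined dually. For $\omega\in\mathbb{E}(Y,Q)$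 and $\iota\in\mathbb{E}(J,X)$ there are connecting maps $$\omega_\sharp\colon\mathbb{E}_{\mathrm I}^{-1}(X,Y)\to\mathscr{C}(X,Q),\ \varphi\mapsto\varphi_Q(\omega),\qquad \iota^\sharp\colon\mathbb{E}_{\mathrm{II}}^{-1}(X,Y)\to\mathscr{C}(J,Y),\ \psi\mapsto\psi_J(\iota),$$ $$\iota^\sharp\colon\mathscr{C}(X,Q)\to\mathbb{E}(J,Q),\ s\mapsto s_*\iota,\qquad \omega_\sharp\colon\mathscr{C}(J,Y)\to\mathbb{E}(J,Q),\ t\mapsto t^*\omega .$$ (A) Assume that there are enough projective morphisms and enough injective morphisms. Let $X\xrightarrow{i}I\xrightarrow{j}J\overset{\iota}{\dashrightarrow}$ and $Q\xrightarrow{q}P\xrightarrow{p}Y\overset{\omega}{\dashrightarrow}$ be $\mathfrak{s}$-triangles in which $i$ is an injective morphism and $p$ is a projective morphism. Then $$\mathbb{E}_{\mathrm I}^{-1}(J,Y)\xrightarrow{j^*}\mathbb{E}_{\mathrm I}^{-1}(I,Y)\xrightarrow{i^*}\mathbb{E}_{\mathrm I}^{-1}(X,Y)\xrightarrow{\iota^\sharp\circ\omega_\sharp}\mathbb{E}(J,Q)$$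 and $$\mathbb{E}_{\mathrm{II}}^{-1}(X,Q)\xrightarrow{q_*}\mathbb{E}_{\mathrm{II}}^{-1}(X,P)\xrightarrow{p_*}\mathbb{E}_{\mathrm{II}}^{-1}(X,Y)\xrightarrow{\omega_\sharp\circ\iota^\sharp}\mathbb{E}(J,Q)$$ are complexes, and their cohomologies are isomorphic $R$-modules in each of the four degrees (at the two ends, the cohomology is the kernel of the first map and the cokernel of the last one). (B) Assume that $R=K$ is a field, that $\mathscr{C}$ is $\mathrm{Hom}$-finite over $K$, and that there are enough projective morphisms and enough injective morphisms. Suppose that $\mathbb{E}_{\mathrm I}^{-1}(i,-)=0$ for every injective inflation $i$ and $\mathbb{E}_{\mathrm{II}}^{-1}(-,p)=0$ for every projective deflation $p$. Then $\dim_K\mathbb{E}_{\mathrm I}^{-n}(X,Y)=\dim_K\mathbb{E}_{\mathrm{II}}^{-n}(X,Y)$ for all $X,Y\in\mathscr{C}$ and $n=1,2$. (C) Assume that $R=K$ is a field, that $\mathscr{C}$ is $\mathrm{Hom}$-finite over $K$, and that there are enough projective objects and enough injective objects. Then the following are equivalent. 1. Both conditions hold: (NI) $\mathscr{C}(I,x)\colon\mathscr{C}(I,A)\to\mathscr{C}(I,B)$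 is a monomorphism for every injective object $I$ and every inflation $x\colon A\to B$; (NII) $\mathscr{C}(y,P)\colon\mathscr{C}(D,P)\to\mathscr{C}(B,P)$ is a monomorphism for every projective object $P$ and every deflation $y\colon B\to D$. 2. $\dim_K\mathbb{E}_{\mathrm I}^{-1}(X,Y)=\dim_K\mathbb{E}_{\mathrm{II}}^{-1}(X,Y)$ for all $X,Y\in\mathscr{C}$. 3. $\dim_K\mathbb{E}_{\mathrm I}^{-n}(X,Y)=\dim_K\mathbb{E}_{\mathrm{II}}^{-n}(X,Y)$ for all $X,Y\in\mathscr{C}$ and all $n>0$. -/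

import Mathlib

open CategoryTheory CategoryTheory.Limits Opposite
open scoped TensorProduct

universe r u v w w'

namespace Extri

/-! ### Three-term sequences up to equivalence -/

section Sequences

variable {C : Type u} [Category.{v} C]

/-- A sequence `A ⟶ B ⟶ D` of morphisms with fixed ends `A` and `D`. -/
structure ThreeTerm (A D : C) where
  mid : C
  inl : A ⟶ mid
  out : mid ⟶ D

/-- Two sequences with the same ends are equivalent if there is an isomorphism of the middle
terms that is compatible with the identities of the ends. -/
instance threeTermSetoid (A D : C) : Setoid (ThreeTerm A D) where
  r S T := ∃ b : S.mid ≅ T.mid, S.inl ≫ b.hom = T.inl ∧ b.hom ≫ T.out = S.out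
  iseqv :=
    { refl := fun S => ⟨Iso.refl _, by simp, by simp⟩
      symm := by
        rintro S T ⟨b, h₁, h₂⟩
        exact ⟨b.symm, by simp [← h₁], by simp [← h₂]⟩
      trans := by
        rintro S T U ⟨b, h₁, h₂⟩ ⟨c, h₃, h₄⟩
        exact ⟨b ≪≫ c, by simp [← h₃, ← h₁], by simp [← h₂, ← h₄]⟩ }

/-- The equivalence class `[A ⟶ B ⟶ D]`. -/
def seqClass {A B D : C} (x : A ⟶ B) (y : B ⟶ D) : Quotient (threeTermSetoid A D) :=
  Quotient.mk _ ⟨B, x, y⟩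

end Sequences

/-! ### Bifunctors with values in modules -/

section Bifunctors

variable {R : Type r} [CommRing R] {C : Type u} [Category.{v} C]

/-- The module `E(D, A)`; its elements are the `E`-extensions of `D` by `A`. -/
abbrev Val (E : Cᵒᵖ ⥤ C ⥤ ModuleCat.{w} R) (D A : C) : Type w := (E.obj (op D)).obj A

/-- `E(D, a)`, written `a_*`. -/
def push (E : Cᵒᵖ ⥤ C ⥤ ModuleCat.{w} R) {A A' : C} (D : C) (a : A ⟶ A') :
    Val E D A →ₗ[R] Val E D A' := ((E.obj (op D)).map a).hom

/-- `E(c, A)`, written `c^*`. -/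
def pull (E : Cᵒᵖ ⥤ C ⥤ ModuleCat.{w} R) {D D' : C} (A : C) (c : D' ⟶ D) :
    Val E D A →ₗ[R] Val E D' A := ((E.map c.op).app A).hom

/-- The direct sum `δ₁ ⊕ δ₂` of two extensions: the extension of `D₁ ⊞ D₂` by `A₁ ⊞ A₂` with
diagonal components `δ₁`, `δ₂` and vanishing off-diagonal components. -/
noncomputable def extSum [Preadditive C] [HasBinaryBiproducts C]
    (E : Cᵒᵖ ⥤ C ⥤ ModuleCat.{w} R) {A₁ D₁ A₂ D₂ : C} (δ₁ : Val E D₁ A₁) (δ₂ : Val E D₂ A₂) :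
    Val E (D₁ ⊞ D₂) (A₁ ⊞ A₂) :=
  pull E _ biprod.fst (push E _ biprod.inl δ₁) + pull E _ biprod.snd (push E _ biprod.inr δ₂)

end Bifunctors

/-! ### Extriangulated categories -/

/-- An `R`-linear extriangulated structure `(E, s)` on an additive `R`-linear category `C`. -/
structure ExtriangulatedStructure (R : Type r) [CommRing R] (C : Type u) [Category.{v} C]
    [Preadditive C] [Linear R C] [HasZeroObject C] [HasBinaryBiproducts C] where
  /-- (ET1) The bifunctor `E`; the next four fields say that it is `R`-bilinear. -/
  E : Cᵒᵖ ⥤ C ⥤ ModuleCat.{w} R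
  push_add : ∀ {A A' : C} (D : C) (a a' : A ⟶ A') (δ : Val E D A),
    push E D (a + a') δ = push E D a δ + push E D a' δ
  push_smul : ∀ {A A' : C} (D : C) (t : R) (a : A ⟶ A') (δ : Val E D A),
    push E D (t • a) δ = t • push E D a δ
  pull_add : ∀ {D D' : C} (A : C) (c c' : D' ⟶ D) (δ : Val E D A),
    pull E A (c + c') δ = pull E A c δ + pull E A c' δ
  pull_smul : ∀ {D D' : C} (A : C) (t : R) (c : D' ⟶ D) (δ : Val E D A),
    pull E A (t • c) δ = t • pull E A c δ
  /-- (ET2) The realization `s`. -/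
  s : ∀ {A D : C}, Val E D A → Quotient (threeTermSetoid A D)
  /-- Morphisms of extensions lift to morphisms of the realizing sequences. -/
  s_lift : ∀ {A B D A' B' D' : C} (δ : Val E D A) (δ' : Val E D' A')
    (x : A ⟶ B) (y : B ⟶ D) (x' : A' ⟶ B') (y' : B' ⟶ D'),
    s δ = seqClass x y → s δ' = seqClass x' y' →
    ∀ (a : A ⟶ A') (c : D ⟶ D'), push E D a δ = pull E A' c δ' →
      ∃ b : B ⟶ B', x ≫ b = a ≫ x' ∧ b ≫ y' = y ≫ c
  /-- The split extension is realized by the split sequence. -/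
  s_zero : ∀ (A D : C),
    s (0 : Val E D A) = seqClass (biprod.inl : A ⟶ A ⊞ D) (biprod.snd : A ⊞ D ⟶ D)
  /-- The realization is compatible with direct sums. -/
  s_sum : ∀ {A B D A' B' D' : C} (δ : Val E D A) (δ' : Val E D' A')
    (x : A ⟶ B) (y : B ⟶ D) (x' : A' ⟶ B') (y' : B' ⟶ D'),
    s δ = seqClass x y → s δ' = seqClass x' y' →
    s (extSum E δ δ') = seqClass (biprod.map x x') (biprod.map y y')
  /-- (ET3) -/
  et3 : ∀ {A B D A' B' D' : C} (δ : Val E D A) (δ' : Val E D' A')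
    (x : A ⟶ B) (y : B ⟶ D) (x' : A' ⟶ B') (y' : B' ⟶ D'),
    s δ = seqClass x y → s δ' = seqClass x' y' →
    ∀ (a : A ⟶ A') (b : B ⟶ B'), x ≫ b = a ≫ x' →
      ∃ c : D ⟶ D', push E D a δ = pull E A' c δ' ∧ y ≫ c = b ≫ y'
  /-- (ET3), dual -/
  et3_op : ∀ {A B D A' B' D' : C} (δ : Val E D A) (δ' : Val E D' A')
    (x : A ⟶ B) (y : B ⟶ D) (x' : A' ⟶ B') (y' : B' ⟶ D'),
    s δ = seqClass x y → s δ' = seqClass x' y' →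
    ∀ (b : B ⟶ B') (c : D ⟶ D'), b ≫ y' = y ≫ c →
      ∃ a : A ⟶ A', push E D a δ = pull E A' c δ' ∧ x ≫ b = a ≫ x'
  /-- (ET4) -/
  et4 : ∀ {A B D M F : C} (δ : Val E D A) (δ' : Val E F B)
    (f : A ⟶ B) (f' : B ⟶ D) (g : B ⟶ M) (g' : M ⟶ F),
    s δ = seqClass f f' → s δ' = seqClass g g' →
    ∃ (N : C) (h : A ⟶ M) (h' : M ⟶ N) (d : D ⟶ N) (e : N ⟶ F) (δ'' : Val E N A),
      f ≫ g = h ∧ f' ≫ d = g ≫ h' ∧ h' ≫ e = g' ∧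
      s δ'' = seqClass h h' ∧
      s (push E F f' δ') = seqClass d e ∧
      pull E A d δ'' = δ ∧
      push E N f δ'' = pull E B e δ'
  /-- (ET4), dual -/
  et4_op : ∀ {A B D M F : C} (δ : Val E A D) (δ' : Val E B F)
    (f' : D ⟶ B) (f : B ⟶ A) (g' : F ⟶ M) (g : M ⟶ B),
    s δ = seqClass f' f → s δ' = seqClass g' g →
    ∃ (N : C) (h' : N ⟶ M) (h : M ⟶ A) (d : N ⟶ D) (e : F ⟶ N) (δ'' : Val E A N),
      g ≫ f = h ∧ d ≫ f' = h' ≫ g ∧ e ≫ h' = g' ∧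
      s δ'' = seqClass h' h ∧
      s (pull E F f' δ') = seqClass e d ∧
      push E A d δ'' = δ ∧
      pull E N f δ'' = push E B e δ'

/-! ### Higher extensions -/

section Higher

variable {R : Type r} [CommRing R] {C : Type u} [Category.{v} C]

/-- `a ⊗ c` for morphisms of modules. -/
noncomputable def tensorMap {M₁ M₂ : ModuleCat.{w'} R} {N₁ N₂ : ModuleCat.{w} R}
    (a : M₁ ⟶ M₂) (c : N₁ ⟶ N₂) :
    ModuleCat.of R (M₁ ⊗[R] N₁) ⟶ ModuleCat.of R (M₂ ⊗[R] N₂) :=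
  ModuleCat.ofHom (TensorProduct.map a.hom c.hom)

theorem tensorMap_id (M : ModuleCat.{w'} R) (N : ModuleCat.{w} R) :
    tensorMap (𝟙 M) (𝟙 N) = 𝟙 _ := by
  ext : 1
  simp [tensorMap]

theorem tensorMap_comp {M₁ M₂ M₃ : ModuleCat.{w'} R} {N₁ N₂ N₃ : ModuleCat.{w} R}
    (a : M₁ ⟶ M₂) (b : M₂ ⟶ M₃) (c : N₁ ⟶ N₂) (d : N₂ ⟶ N₃) :
    tensorMap a c ≫ tensorMap b d = tensorMap (a ≫ b) (c ≫ d) := by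
  ext : 1
  simp [tensorMap, ← TensorProduct.map_comp]

/-- The bifunctor `(M, N) ↦ G(M) ⊗ F(N)`. -/
noncomputable def tensorBifunctor (G : Cᵒᵖ ⥤ ModuleCat.{w'} R)
    (F : C ⥤ ModuleCat.{w} R) : Cᵒᵖ ⥤ C ⥤ ModuleCat.{max w' w} R where
  obj M :=
    { obj := fun N => ModuleCat.of R (G.obj M ⊗[R] F.obj N)
      map := fun f => tensorMap (𝟙 (G.obj M)) (F.map f)
      map_id := fun N => by rw [F.map_id, tensorMap_id]
      map_comp := fun f g => by rw [tensorMap_comp, F.map_comp, Category.comp_id] }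
  map f :=
    { app := fun N => tensorMap (G.map f) (𝟙 (F.obj N))
      naturality := fun N N' g => by
        simp only [tensorMap_comp, Category.comp_id, Category.id_comp] }
  map_id M := by
    ext N : 2
    exact (congrArg (fun a => tensorMap a (𝟙 (F.obj N))) (G.map_id M)).trans (tensorMap_id _ _)
  map_comp f g := by
    ext N : 2
    refine Eq.trans ?_ (tensorMap_comp (G.map f) (G.map g) (𝟙 (F.obj N)) (𝟙 (F.obj N))).symm
    simp only [G.map_comp, Category.comp_id]

/-- The transformation of `tensorBifunctor`s induced by transformations of both factors. -/
noncomputable def tensorBifunctorMap {G G' : Cᵒᵖ ⥤ ModuleCat.{w'} R}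
    {F F' : C ⥤ ModuleCat.{w} R} (α : G ⟶ G') (β : F ⟶ F') :
    tensorBifunctor G F ⟶ tensorBifunctor G' F' where
  app M :=
    { app := fun N => tensorMap (α.app M) (β.app N)
      naturality := fun N N' g => by
        refine (tensorMap_comp _ _ _ _).trans (Eq.trans ?_ (tensorMap_comp _ _ _ _).symm)
        rw [Category.id_comp, Category.comp_id, β.naturality] }
  naturality M M' f := by
    ext N : 2
    refine (tensorMap_comp _ _ _ _).trans (Eq.trans ?_ (tensorMap_comp _ _ _ _).symm)
    rw [Category.id_comp, Category.comp_id, α.naturality]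

theorem tensorBifunctorMap_id (G : Cᵒᵖ ⥤ ModuleCat.{w'} R) (F : C ⥤ ModuleCat.{w} R) :
    tensorBifunctorMap (𝟙 G) (𝟙 F) = 𝟙 _ := by
  ext M N : 4
  exact tensorMap_id _ _

theorem tensorBifunctorMap_comp {G G' G'' : Cᵒᵖ ⥤ ModuleCat.{w'} R}
    {F F' F'' : C ⥤ ModuleCat.{w} R} (α : G ⟶ G') (α' : G' ⟶ G'') (β : F ⟶ F') (β' : F' ⟶ F'') :
    tensorBifunctorMap α β ≫ tensorBifunctorMap α' β' =
      tensorBifunctorMap (α ≫ α') (β ≫ β') := by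
  ext M N : 4
  exact tensorMap_comp _ _ _ _

/-- The functor `Y ↦ ∫^M G(M, Y) ⊗ F(M)`. -/
noncomputable def diamondObj (G : Cᵒᵖ ⥤ C ⥤ ModuleCat.{max u v w} R)
    (F : C ⥤ ModuleCat.{w} R) : C ⥤ ModuleCat.{max u v w} R where
  obj Y := coend (tensorBifunctor.{r, u, v, w, max u v w} (G.flip.obj Y) F)
  map b := coend.map (tensorBifunctorMap (G.flip.map b) (𝟙 F))
  map_id Y := by rw [CategoryTheory.Functor.map_id, tensorBifunctorMap_id, coend.map_id]
  map_comp b b' := by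
    rw [coend.map_comp, tensorBifunctorMap_comp, CategoryTheory.Functor.map_comp,
      Category.comp_id]

/-- The transformation of `diamondObj`s induced by a transformation of the second factor. -/
noncomputable def diamondMap (G : Cᵒᵖ ⥤ C ⥤ ModuleCat.{max u v w} R)
    {F F' : C ⥤ ModuleCat.{w} R} (β : F ⟶ F') : diamondObj G F ⟶ diamondObj G F' where
  app Y := coend.map (tensorBifunctorMap (𝟙 (G.flip.obj Y)) β)
  naturality Y Y' b := by
    simp only [diamondObj, coend.map_comp, tensorBifunctorMap_comp, Category.comp_id,
      Category.id_comp]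

/-- The composite of bimodules `(G ◇ F)(X, Y) = ∫^M G(M, Y) ⊗ F(X, M)`. -/
noncomputable def diamond (G : Cᵒᵖ ⥤ C ⥤ ModuleCat.{max u v w} R)
    (F : Cᵒᵖ ⥤ C ⥤ ModuleCat.{w} R) : Cᵒᵖ ⥤ C ⥤ ModuleCat.{max u v w} R where
  obj X := diamondObj G (F.obj X)
  map a := diamondMap G (F.map a)
  map_id X := by
    ext Y : 2
    rw [F.map_id]
    exact (congrArg coend.map (tensorBifunctorMap_id _ _)).trans coend.map_id
  map_comp a a' := by
    ext Y : 2
    rw [F.map_comp]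
    refine Eq.trans ?_ (coend.map_comp _ _).symm
    exact congrArg coend.map (by rw [tensorBifunctorMap_comp, Category.comp_id])

end Higher

namespace ExtriangulatedStructure

variable {R : Type r} [CommRing R] {C : Type u} [Category.{v} C] [Preadditive C] [Linear R C]
  [HasZeroObject C] [HasBinaryBiproducts C] (T : ExtriangulatedStructure.{r, u, v, w} R C)

/-- The `n`-th extension bifunctor `E^n`: it is `Hom` for `n = 0`, it is `E` for `n = 1`, and
`E^{n+1} = E^n ◇ E` for `n ≥ 1`. The values are lifted to a common universe. -/
noncomputable def Ext : ℕ → (Cᵒᵖ ⥤ C ⥤ ModuleCat.{max u v w} R)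
  | 0 => linearCoyoneda R C ⋙
      (Functor.whiskeringRight _ _ _).obj (ModuleCat.uliftFunctor.{max u w, v} R)
  | 1 => T.E ⋙
      (Functor.whiskeringRight _ _ _).obj (ModuleCat.uliftFunctor.{max u v, w} R)
  | n + 2 => diamond (Ext (n + 1)) T.E

/-! ### Triangles, projectivity and injectivity -/

/-- `A ⟶ B ⟶ D` together with `δ` is an `s`-triangle. -/
def Triangle {A B D : C} (x : A ⟶ B) (y : B ⟶ D) (δ : Val T.E D A) : Prop :=
  T.s δ = seqClass x y

def IsInflation {A B : C} (x : A ⟶ B) : Prop :=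
  ∃ (D : C) (y : B ⟶ D) (δ : Val T.E D A), T.Triangle x y δ

def IsDeflation {B D : C} (y : B ⟶ D) : Prop :=
  ∃ (A : C) (x : A ⟶ B) (δ : Val T.E D A), T.Triangle x y δ

/-- `f` is a projective morphism: `E(f, -) = 0`. -/
def IsProjMor {X Y : C} (f : X ⟶ Y) : Prop := ∀ A : C, pull T.E A f = 0

/-- `f` is an injective morphism: `E(-, f) = 0`. -/
def IsInjMor {X Y : C} (f : X ⟶ Y) : Prop := ∀ D : C, push T.E D f = 0

/-- Morphisms from `P` lift along deflations. -/
def IsProjObj (P : C) : Prop :=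
  ∀ {B D : C} (y : B ⟶ D), T.IsDeflation y → ∀ c : P ⟶ D, ∃ b : P ⟶ B, b ≫ y = c

/-- Morphisms to `I` extend along inflations. -/
def IsInjObj (I : C) : Prop :=
  ∀ {A B : C} (x : A ⟶ B), T.IsInflation x → ∀ a : A ⟶ I, ∃ b : B ⟶ I, x ≫ b = a

def EnoughProjMor : Prop := ∀ D : C, ∃ (G : C) (g : G ⟶ D), T.IsDeflation g ∧ T.IsProjMor g

def EnoughInjMor : Prop := ∀ A : C, ∃ (I : C) (i : A ⟶ I), T.IsInflation i ∧ T.IsInjMor i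

def EnoughProjObj : Prop := ∀ D : C, ∃ (P : C) (p : P ⟶ D), T.IsProjObj P ∧ T.IsDeflation p

def EnoughInjObj : Prop := ∀ A : C, ∃ (I : C) (i : A ⟶ I), T.IsInjObj I ∧ T.IsInflation i

/-- Condition (NI). -/
def NI : Prop := ∀ (I : C), T.IsInjObj I → ∀ {A B : C} (x : A ⟶ B), T.IsInflation x →
  Function.Injective (fun f : I ⟶ A => f ≫ x)

/-- Condition (NII). -/
def NII : Prop := ∀ (P : C), T.IsProjObj P → ∀ {B D : C} (y : B ⟶ D), T.IsDeflation y →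
  Function.Injective (fun f : D ⟶ P => y ≫ f)

/-! ### Negative extensions -/

/-- `E_I^{-n}(X, Y)`: the natural transformations `E^n(Y, -) ⟶ Hom(X, -)`. -/
abbrev NegI (n : ℕ) (X Y : C) : Type (max u v w) :=
  (T.Ext n).obj (op Y) ⟶ (T.Ext 0).obj (op X)

/-- `E_II^{-n}(X, Y)`: the natural transformations `E^n(-, X) ⟶ Hom(-, Y)`. -/
abbrev NegII (n : ℕ) (X Y : C) : Type (max u v w) :=
  (T.Ext n).flip.obj X ⟶ (T.Ext 0).flip.obj Y

/-- `c^* : E_I^{-n}(X, Y) ⟶ E_I^{-n}(X', Y)` for `c : X' ⟶ X`. -/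
noncomputable def negIPull (n : ℕ) {X X' : C} (Y : C) (c : X' ⟶ X) :
    T.NegI n X Y →ₗ[R] T.NegI n X' Y :=
  Linear.rightComp R _ ((T.Ext 0).map c.op)

/-- `a_* : E_II^{-n}(X, Y) ⟶ E_II^{-n}(X, Y')` for `a : Y ⟶ Y'`. -/
noncomputable def negIIPush (n : ℕ) (X : C) {Y Y' : C} (a : Y ⟶ Y') :
    T.NegII n X Y →ₗ[R] T.NegII n X Y' :=
  Linear.rightComp R _ ((T.Ext 0).flip.map a)

/-- The connecting map `ω_♯ : E_I^{-1}(X, Y) ⟶ Hom(X, Q)` of `ω ∈ E(Y, Q)`. It is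
precomposition with `Hom(Q, -) ⟶ E(Y, -)`, `s ↦ s_* ω`, followed by the Yoneda isomorphism,
so it sends `φ` to `φ_Q(ω)`. -/
noncomputable def negIConn {Y Q : C} (ω : Val T.E Y Q) (X : C) :
    T.NegI 1 X Y →ₗ[R] (X ⟶ Q) where
  toFun φ := ULift.down ((φ.app Q).hom (ULift.up ω))
  map_add' _ _ := rfl
  map_smul' _ _ := rfl

/-- The connecting map `ι^♯ : E_II^{-1}(X, Y) ⟶ Hom(J, Y)` of `ι ∈ E(J, X)`. It is
precomposition with `Hom(-, J) ⟶ E(-, X)`, `t ↦ t^* ι`, followed by the Yoneda isomorphism,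
so it sends `ψ` to `ψ_J(ι)`. -/
noncomputable def negIIConn {J X : C} (ι : Val T.E J X) (Y : C) :
    T.NegII 1 X Y →ₗ[R] (J ⟶ Y) where
  toFun ψ := ULift.down ((ψ.app (op J)).hom (ULift.up ι))
  map_add' _ _ := rfl
  map_smul' _ _ := rfl

/-- The connecting map `ι^♯ : Hom(X, Q) ⟶ E(J, Q)`, `s ↦ s_* ι`, of `ι ∈ E(J, X)`. -/
noncomputable def homConnUpper {J X : C} (ι : Val T.E J X) (Q : C) :
    (X ⟶ Q) →ₗ[R] Val T.E J Q where
  toFun s := push T.E J s ι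
  map_add' s s' := T.push_add J s s' ι
  map_smul' t s := T.push_smul J t s ι

/-- The connecting map `ω_♯ : Hom(J, Y) ⟶ E(J, Q)`, `t ↦ t^* ω`, of `ω ∈ E(Y, Q)`. -/
noncomputable def homConnLower {Y Q : C} (ω : Val T.E Y Q) (J : C) :
    (J ⟶ Y) →ₗ[R] Val T.E J Q where
  toFun t := pull T.E Q t ω
  map_add' t t' := T.pull_add Q t t' ω
  map_smul' k t := T.pull_smul Q k t ω

/-- The last differential `ι^♯ ∘ ω_♯ : E_I^{-1}(X, Y) ⟶ Hom(X, Q) ⟶ E(J, Q)`. -/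
noncomputable def lastI {X J Y Q : C} (ι : Val T.E J X) (ω : Val T.E Y Q) :
    T.NegI 1 X Y →ₗ[R] Val T.E J Q :=
  T.homConnUpper ι Q ∘ₗ T.negIConn ω X

/-- The last differential `ω_♯ ∘ ι^♯ : E_II^{-1}(X, Y) ⟶ Hom(J, Y) ⟶ E(J, Q)`. -/
noncomputable def lastII {X J Y Q : C} (ι : Val T.E J X) (ω : Val T.E Y Q) :
    T.NegII 1 X Y →ₗ[R] Val T.E J Q :=
  T.homConnLower ω J ∘ₗ T.negIIConn ι Y

end ExtriangulatedStructure

/-- The cohomology `Ker g / Im f` at the middle term of a complex `L ⟶ M ⟶ N`. -/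
abbrev Cohomology {R : Type r} [CommRing R] {L : Type u} {M : Type v} {N : Type w}
    [AddCommGroup L] [AddCommGroup M] [AddCommGroup N] [Module R L] [Module R M] [Module R N]
    (f : L →ₗ[R] M) (g : M →ₗ[R] N) : Type v :=
  LinearMap.ker g ⧸ (LinearMap.range f).submoduleOf (LinearMap.ker g)

end Extri

namespace Extri

open scoped ZeroObject

section Bifunctors

variable {R : Type r} [CommRing R] {C : Type u} [Category.{v} C]
  (E : Cᵒᵖ ⥤ C ⥤ ModuleCat.{w} R)

/-! Write `Q ⟶ P ⟶ Y` for a triangle with class `ω` whose deflation is a projective morphism, and `X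
⟶ I ⟶ J` for one with class `ι` whose inflation is an injective morphism. Then `C(P, -) ⟶ C(Q, -) ⟶
E(Y, -) ⟶ 0` is exact, so by Yoneda `φ ↦ φ_Q(ω)` identifies `E_I^{-1}(X, Y)` with the morphisms `X ⟶
Q` killed by `q`. Dually, `E_II^{-1}(X, Y)` consists of the morphisms `J ⟶ Y` killed by `j`
(`negIEquiv`, `negIIEquiv`).

(A) becomes a diagram chase among morphisms from `X ⟶ I ⟶ J` to `Q ⟶ P ⟶ Y`. In each of the first
three degrees one module of such morphisms serves both complexes, directly or through quotients by
the same submodule. In the last degree the two differentials have the same image, by (ET3) and its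
dual.

(B) In degree -1 the vanishing assumptions turn the third cohomologies into kernels of the last
differentials; equal images then give equal dimensions. In degree -2, right exactness of the coend
gives `E_I^{-2}(X, Y) = ker(E_I^{-1}(X, Q) ⟶ E_I^{-1}(X, P))` and dually for `E_II^{-2}`.
Resolutions built from two successive projective deflations (or injective inflations) make the maps
in question surjective, so degree -1 fixes the dimensions of the kernels, and the first isomorphism
of (A) links the two sides.

(C) (NI) and (NII) imply the assumptions of (B), and dimension shifting reaches all degrees.
Conversely, `E_II^{-1}(I, -)` vanishes for injective `I`, so equal dimensions kill `E_I^{-1}(I, -)`;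
a morphism violating (NI) would produce a nonzero element there. (NII) is dual. -/

theorem push_id {A D : C} (δ : Val E D A) : push E D (𝟙 A) δ = δ := by
  simp [push]

theorem pull_id {A D : C} (δ : Val E D A) : pull E A (𝟙 D) δ = δ := by
  simp [pull]

theorem push_comp {A A' A'' D : C} (a : A ⟶ A') (a' : A' ⟶ A'') (δ : Val E D A) :
    push E D (a ≫ a') δ = push E D a' (push E D a δ) := by
  simp [push]

theorem pull_comp {A D D' D'' : C} (c : D' ⟶ D) (c' : D'' ⟶ D') (δ : Val E D A) :
    pull E A (c' ≫ c) δ = pull E A c' (pull E A c δ) := by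
  simp [pull]

end Bifunctors

namespace ExtriangulatedStructure

variable {R : Type r} [CommRing R] {C : Type u} [Category.{v} C] [Preadditive C] [Linear R C]
  [HasZeroObject C] [HasBinaryBiproducts C] (T : ExtriangulatedStructure.{r, u, v, w} R C)

/-! ### Bilinearity -/

theorem push_zero {A A' D : C} (δ : Val T.E D A) : push T.E D (0 : A ⟶ A') δ = 0 := by
  simpa using T.push_smul D 0 (0 : A ⟶ A') δ

theorem pull_zero {A D D' : C} (δ : Val T.E D A) : pull T.E A (0 : D' ⟶ D) δ = 0 := by
  simpa using T.pull_smul A 0 (0 : D' ⟶ D) δ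

theorem push_sub {A A' D : C} (a a' : A ⟶ A') (δ : Val T.E D A) :
    push T.E D (a - a') δ = push T.E D a δ - push T.E D a' δ := by
  rw [eq_sub_iff_add_eq, ← T.push_add, sub_add_cancel]

theorem pull_sub {A D D' : C} (c c' : D' ⟶ D) (δ : Val T.E D A) :
    pull T.E A (c - c') δ = pull T.E A c δ - pull T.E A c' δ := by
  rw [eq_sub_iff_add_eq, ← T.pull_add, sub_add_cancel]

/-! ### Exact sequences attached to a triangle -/

theorem triangle_zero (A D : C) :
    T.Triangle (biprod.inl : A ⟶ A ⊞ D) (biprod.snd : A ⊞ D ⟶ D) 0 := T.s_zero A D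

theorem exists_triangle {A D : C} (δ : Val T.E D A) :
    ∃ (B : C) (x : A ⟶ B) (y : B ⟶ D), T.Triangle x y δ := by
  obtain ⟨⟨B, x, y⟩, h⟩ := Quotient.exists_rep (T.s δ)
  exact ⟨B, x, y, h.symm⟩

section Triangle

variable {T} {A B D : C} {x : A ⟶ B} {y : B ⟶ D} {δ : Val T.E D A}

/-- (ET3) compares the split triangle `A ⟶ A ⊞ 0 ⟶ 0` with the given one. The exactness statements
below likewise come from comparing with a split triangle that has a zero end or an identity end. -/
theorem Triangle.comp_eq_zero (h : T.Triangle x y δ) : x ≫ y = 0 := by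
  obtain ⟨c, -, hc⟩ := T.et3 (0 : Val T.E (0 : C) A) δ _ _ x y (T.triangle_zero A 0) h
    (𝟙 A) (biprod.fst ≫ x) (by simp)
  have := biprod.inl ≫= hc
  simpa using this.symm

theorem Triangle.push_eq_zero (h : T.Triangle x y δ) : push T.E D x δ = 0 := by
  obtain ⟨c, hc, -⟩ := T.et3 δ (0 : Val T.E (0 : C) B) x y _ _ h (T.triangle_zero B 0)
    x biprod.inl rfl
  rw [hc, map_zero]

theorem Triangle.pull_eq_zero (h : T.Triangle x y δ) : pull T.E A y δ = 0 := by
  obtain ⟨c, hc, -⟩ := T.et3_op (0 : Val T.E B (0 : C)) δ _ _ x y (T.triangle_zero 0 B) h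
    biprod.snd y rfl
  rw [← hc, map_zero]

theorem Triangle.exists_desc (h : T.Triangle x y δ) {Z : C} (f : B ⟶ Z) (hf : x ≫ f = 0) :
    ∃ g : D ⟶ Z, y ≫ g = f := by
  obtain ⟨c, -, hc⟩ := T.et3 δ (0 : Val T.E Z (0 : C)) x y _ _ h (T.triangle_zero 0 Z)
    0 (f ≫ biprod.inr) (by simp [← Category.assoc, hf])
  exact ⟨c, by simpa using hc⟩

theorem Triangle.exists_lift (h : T.Triangle x y δ) {Z : C} (f : Z ⟶ B) (hf : f ≫ y = 0) :
    ∃ g : Z ⟶ A, g ≫ x = f := by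
  obtain ⟨c, -, hc⟩ := T.et3_op (0 : Val T.E (0 : C) Z) δ _ _ x y (T.triangle_zero Z 0) h
    (biprod.fst ≫ f) 0 (by simp [hf])
  refine ⟨c, by simpa using hc.symm⟩

theorem Triangle.exists_extension (h : T.Triangle x y δ) {Z : C} (f : A ⟶ Z)
    (hf : push T.E D f δ = 0) : ∃ g : B ⟶ Z, x ≫ g = f := by
  obtain ⟨b, hb, -⟩ := T.s_lift δ (0 : Val T.E D Z) x y _ _ h (T.triangle_zero Z D)
    f (𝟙 D) (by rw [hf, map_zero])
  exact ⟨b ≫ biprod.fst, by rw [← Category.assoc, hb]; simp⟩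

theorem Triangle.exists_lifting (h : T.Triangle x y δ) {Z : C} (f : Z ⟶ D)
    (hf : pull T.E A f δ = 0) : ∃ g : Z ⟶ B, g ≫ y = f := by
  obtain ⟨b, -, hb⟩ := T.s_lift (0 : Val T.E Z A) δ _ _ x y (T.triangle_zero A Z) h
    (𝟙 A) f (by rw [hf, map_zero])
  exact ⟨biprod.inr ≫ b, by rw [Category.assoc, hb]; simp⟩

/-- Realize `ε` by `Z ⟶ B' ⟶ D`. Since `y^* ε = 0`, `y` lifts to `B ⟶ B'` over the identity of `D`,
and the dual of (ET3) restricts this lift to `A ⟶ Z`. -/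
theorem Triangle.exists_push_eq (h : T.Triangle x y δ) {Z : C} (ε : Val T.E D Z)
    (hε : pull T.E Z y ε = 0) : ∃ a : A ⟶ Z, push T.E D a δ = ε := by
  obtain ⟨B', x', y', h'⟩ := T.exists_triangle ε
  obtain ⟨b, hb⟩ := h'.exists_lifting y hε
  obtain ⟨a, ha, -⟩ := T.et3_op δ ε x y x' y' h h' b (𝟙 D) (by simp [hb])
  exact ⟨a, by rw [ha, pull_id]⟩

theorem Triangle.exists_pull_eq (h : T.Triangle x y δ) {Z : C} (ε : Val T.E Z A)
    (hε : push T.E Z x ε = 0) : ∃ c : Z ⟶ D, pull T.E A c δ = ε := by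
  obtain ⟨B', x', y', h'⟩ := T.exists_triangle ε
  obtain ⟨b, hb⟩ := h'.exists_extension x hε
  obtain ⟨c, hc, -⟩ := T.et3 ε δ x' y' x y h' h (𝟙 A) b (by simp [hb])
  exact ⟨c, by rw [← hc, push_id]⟩

theorem Triangle.isInflation (h : T.Triangle x y δ) : T.IsInflation x := ⟨D, y, δ, h⟩

theorem Triangle.isDeflation (h : T.Triangle x y δ) : T.IsDeflation y := ⟨A, x, δ, h⟩

end Triangle

/-! ### Projective and injective morphisms and objects -/

section ProjInj

variable {T}

/-- Universality of `ω`: the functor `E(Y, -)` is generated by this one element. -/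
theorem IsProjMor.exists_push_eq {Q P Y : C} {q : Q ⟶ P} {p : P ⟶ Y} {ω : Val T.E Y Q}
    (hp : T.IsProjMor p) (h : T.Triangle q p ω) {Z : C} (ε : Val T.E Y Z) :
    ∃ a : Q ⟶ Z, push T.E Y a ω = ε :=
  h.exists_push_eq ε (by rw [hp Z, LinearMap.zero_apply])

theorem IsInjMor.exists_pull_eq {X I J : C} {i : X ⟶ I} {j : I ⟶ J} {ι : Val T.E J X}
    (hi : T.IsInjMor i) (h : T.Triangle i j ι) {Z : C} (ε : Val T.E Z X) :
    ∃ c : Z ⟶ J, pull T.E X c ι = ε :=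
  h.exists_pull_eq ε (by rw [hi Z, LinearMap.zero_apply])

theorem IsProjMor.exists_lifting {Z B D : C} {f : Z ⟶ D} (hf : T.IsProjMor f) {y : B ⟶ D}
    (hy : T.IsDeflation y) : ∃ g : Z ⟶ B, g ≫ y = f := by
  obtain ⟨A, x, δ, h⟩ := hy
  exact h.exists_lifting f (by rw [hf A, LinearMap.zero_apply])

theorem IsInjMor.exists_extension {Z A B : C} {f : A ⟶ Z} (hf : T.IsInjMor f) {x : A ⟶ B}
    (hx : T.IsInflation x) : ∃ g : B ⟶ Z, x ≫ g = f := by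
  obtain ⟨D, y, δ, h⟩ := hx
  exact h.exists_extension f (by rw [hf D, LinearMap.zero_apply])

theorem IsProjMor.comp {X Y Z : C} {f : X ⟶ Y} (hf : T.IsProjMor f) (g : Y ⟶ Z) :
    T.IsProjMor (f ≫ g) := fun A => by
  ext ε
  rw [pull_comp, hf A, LinearMap.zero_apply, LinearMap.zero_apply]

theorem IsProjMor.comp' {X Y Z : C} (f : X ⟶ Y) {g : Y ⟶ Z} (hg : T.IsProjMor g) :
    T.IsProjMor (f ≫ g) := fun A => by
  ext ε
  rw [pull_comp, hg A, LinearMap.zero_apply, map_zero, LinearMap.zero_apply]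

theorem IsInjMor.comp {X Y Z : C} {f : X ⟶ Y} (hf : T.IsInjMor f) (g : Y ⟶ Z) :
    T.IsInjMor (f ≫ g) := fun A => by
  ext ε
  rw [push_comp, hf A, LinearMap.zero_apply, map_zero, LinearMap.zero_apply]

theorem IsInjMor.comp' {X Y Z : C} (f : X ⟶ Y) {g : Y ⟶ Z} (hg : T.IsInjMor g) :
    T.IsInjMor (f ≫ g) := fun A => by
  ext ε
  rw [push_comp, hg A, LinearMap.zero_apply, LinearMap.zero_apply]

theorem IsProjObj.val_eq_zero {P : C} (hP : T.IsProjObj P) {A : C} (ε : Val T.E P A) :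
    ε = 0 := by
  obtain ⟨B, x, y, h⟩ := T.exists_triangle ε
  obtain ⟨b, hb⟩ := hP y h.isDeflation (𝟙 P)
  rw [← pull_id T.E ε, ← hb, pull_comp, h.pull_eq_zero, map_zero]

theorem IsInjObj.val_eq_zero {I : C} (hI : T.IsInjObj I) {D : C} (ε : Val T.E D I) :
    ε = 0 := by
  obtain ⟨B, x, y, h⟩ := T.exists_triangle ε
  obtain ⟨b, hb⟩ := hI x h.isInflation (𝟙 I)
  rw [← push_id T.E ε, ← hb, push_comp, h.push_eq_zero, map_zero]

theorem IsProjObj.isProjMor {P Y : C} (hP : T.IsProjObj P) (p : P ⟶ Y) : T.IsProjMor p :=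
  fun _ => LinearMap.ext fun _ => hP.val_eq_zero _

theorem IsInjObj.isInjMor {X I : C} (hI : T.IsInjObj I) (i : X ⟶ I) : T.IsInjMor i :=
  fun _ => LinearMap.ext fun _ => hI.val_eq_zero _

theorem EnoughProjObj.enoughProjMor (h : T.EnoughProjObj) : T.EnoughProjMor := fun D =>
  let ⟨P, p, hP, hp⟩ := h D
  ⟨P, p, hp, hP.isProjMor p⟩

theorem EnoughInjObj.enoughInjMor (h : T.EnoughInjObj) : T.EnoughInjMor := fun A =>
  let ⟨I, i, hI, hi⟩ := h A
  ⟨I, i, hi, hI.isInjMor i⟩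

/-- Every object has a projective resolution `Q ⟶ P ⟶ Y` in which the identity of `P` is the sum
of a morphism factoring through `Q` and a morphism factoring through a projective deflation. -/
theorem EnoughProjMor.exists_split_resolution (h : T.EnoughProjMor) (Y : C) :
    ∃ (Q P B : C) (q : Q ⟶ P) (p : P ⟶ Y) (ω : Val T.E Y Q) (v : P ⟶ Q) (a : P ⟶ B)
      (b : B ⟶ P), T.Triangle q p ω ∧ T.IsProjMor p ∧ T.IsDeflation a ∧ T.IsProjMor a ∧
      v ≫ q + a ≫ b = 𝟙 P := by
  -- Take `p = a ≫ p₀` with `a` and `p₀` both projective deflations. Projectivity of `p₀` gives `b`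
  -- with `b ≫ p = p₀`, so `𝟙 - a ≫ b` is killed by `p` and factors through `q`.
  obtain ⟨B, p₀, ⟨Q₀, q₀, ω₀, h₀⟩, hp₀⟩ := h Y
  obtain ⟨P, a, ⟨F, m, δ, ha⟩, hpa⟩ := h B
  obtain ⟨Q, q, p, d, e, ω, rfl, -, -, hω, -⟩ := T.et4_op ω₀ δ q₀ p₀ m a h₀ ha
  obtain ⟨b, hb⟩ := hp₀.exists_lifting (Triangle.isDeflation hω)
  obtain ⟨v, hv⟩ := Triangle.exists_lift hω (𝟙 P - a ≫ b) (by simp [hb])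
  exact ⟨Q, P, B, q, _, ω, v, a, b, hω, hpa.comp _, Triangle.isDeflation ha, hpa, by rw [hv]; simp⟩

/-- Every object has an injective coresolution `X ⟶ I ⟶ J` in which the identity of `I` is the
sum of a morphism factoring through `J` and a morphism factoring through an injective inflation. -/
theorem EnoughInjMor.exists_split_coresolution (h : T.EnoughInjMor) (X : C) :
    ∃ (I J B : C) (i : X ⟶ I) (j : I ⟶ J) (ι : Val T.E J X) (v : J ⟶ I) (a : I ⟶ B)
      (b : B ⟶ I), T.Triangle i j ι ∧ T.IsInjMor i ∧ T.IsInflation b ∧ T.IsInjMor b ∧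
      j ≫ v + a ≫ b = 𝟙 I := by
  obtain ⟨B, i₀, ⟨J₀, j₀, ι₀, h₀⟩, hi₀⟩ := h X
  obtain ⟨I, b, ⟨F, m, δ, hb⟩, hib⟩ := h B
  obtain ⟨J, i, j, d, e, ι, rfl, -, -, hι, -⟩ := T.et4 ι₀ δ i₀ j₀ b m h₀ hb
  obtain ⟨a, ha⟩ := hi₀.exists_extension (Triangle.isInflation hι)
  obtain ⟨v, hv⟩ := Triangle.exists_desc hι (𝟙 I - a ≫ b) (by
    rw [Preadditive.comp_sub, ← Category.assoc (i₀ ≫ b), ha, Category.comp_id, sub_self])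
  exact ⟨I, J, B, _, j, ι, v, a, b, hι, hib.comp' _, Triangle.isInflation hb, hib, by rw [hv]; simp⟩

end ProjInj

end ExtriangulatedStructure

end Extri

namespace Extri

section LinearAlgebra

variable {R : Type r} [CommRing R]

theorem exists_comp_eq_of_ker_le {L : Type*} {M : Type*} {N : Type*} [AddCommGroup L]
    [AddCommGroup M] [AddCommGroup N] [Module R L] [Module R M] [Module R N]
    (π : L →ₗ[R] M) (f : L →ₗ[R] N) (hπ : Function.Surjective π)
    (h : ∀ x, π x = 0 → f x = 0) : ∃ g : M →ₗ[R] N, ∀ x, g (π x) = f x := by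
  refine ⟨(LinearMap.ker π).liftQ f h ∘ₗ (π.quotKerEquivOfSurjective hπ).symm.toLinearMap,
    fun x => ?_⟩
  have : (π.quotKerEquivOfSurjective hπ).symm (π x) = Submodule.Quotient.mk x := by
    rw [LinearEquiv.symm_apply_eq]; rfl
  rw [LinearMap.comp_apply, LinearEquiv.coe_coe, this]
  exact Submodule.liftQ_apply _ _ _

end LinearAlgebra

namespace ExtriangulatedStructure

variable {R : Type r} [CommRing R] {C : Type u} [Category.{v} C] [Preadditive C] [Linear R C]
  [HasZeroObject C] [HasBinaryBiproducts C] (T : ExtriangulatedStructure.{r, u, v, w} R C)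

/-- `c_* : E_I^{-n}(X, Y) ⟶ E_I^{-n}(X, Y')` for `c : Y ⟶ Y'`. -/
noncomputable def negIPush (n : ℕ) (X : C) {Y Y' : C} (c : Y ⟶ Y') :
    T.NegI n X Y →ₗ[R] T.NegI n X Y' :=
  Linear.leftComp R _ ((T.Ext n).map c.op)

/-- `c^* : E_II^{-n}(X', Y) ⟶ E_II^{-n}(X, Y)` for `c : X ⟶ X'`. -/
noncomputable def negIIPull (n : ℕ) {X X' : C} (Y : C) (c : X ⟶ X') :
    T.NegII n X' Y →ₗ[R] T.NegII n X Y :=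
  Linear.leftComp R _ ((T.Ext n).flip.map c)

/-! ### Negative extensions of degree one through their values on extensions -/

section Evaluation

variable {T}

theorem negI_ext {X Y : C} {φ φ' : T.NegI 1 X Y}
    (h : ∀ (Z : C) (ε : Val T.E Y Z), T.negIConn ε X φ = T.negIConn ε X φ') : φ = φ' := by
  ext Z ⟨ε⟩
  exact congrArg ULift.up (h Z ε)

theorem negII_ext {X Y : C} {ψ ψ' : T.NegII 1 X Y}
    (h : ∀ (Z : C) (ε : Val T.E Z X), T.negIIConn ε Y ψ = T.negIIConn ε Y ψ') : ψ = ψ' := by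
  ext Z ⟨ε⟩
  exact congrArg ULift.up (h Z.unop ε)

theorem negIConn_push {X Y Z Z' : C} (ε : Val T.E Y Z) (a : Z ⟶ Z') (φ : T.NegI 1 X Y) :
    T.negIConn (push T.E Y a ε) X φ = T.negIConn ε X φ ≫ a :=
  congrArg (fun f => ULift.down (f.hom (ULift.up ε))) (φ.naturality a)

theorem negIIConn_pull {X Y Z Z' : C} (ε : Val T.E Z X) (c : Z' ⟶ Z) (ψ : T.NegII 1 X Y) :
    T.negIIConn (pull T.E X c ε) Y ψ = c ≫ T.negIIConn ε Y ψ :=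
  congrArg (fun f => ULift.down (f.hom (ULift.up ε))) (ψ.naturality c.op)

theorem negIConn_negIPull {X X' Y Z : C} (ε : Val T.E Y Z) (c : X' ⟶ X) (φ : T.NegI 1 X Y) :
    T.negIConn ε X' (T.negIPull 1 Y c φ) = c ≫ T.negIConn ε X φ := rfl

theorem negIIConn_negIIPush {X Y Y' Z : C} (ε : Val T.E Z X) (a : Y ⟶ Y')
    (ψ : T.NegII 1 X Y) :
    T.negIIConn ε Y' (T.negIIPush 1 X a ψ) = T.negIIConn ε Y ψ ≫ a := rfl

theorem negIConn_negIPush {X Y Y' Z : C} (ε : Val T.E Y' Z) (c : Y ⟶ Y') (φ : T.NegI 1 X Y) :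
    T.negIConn ε X (T.negIPush 1 X c φ) = T.negIConn (pull T.E Z c ε) X φ := rfl

theorem negIIConn_negIIPull {X X' Y Z : C} (ε : Val T.E Z X) (a : X ⟶ X')
    (ψ : T.NegII 1 X' Y) :
    T.negIIConn ε Y (T.negIIPull 1 Y a ψ) = T.negIIConn (push T.E Z a ε) Y ψ := rfl

theorem negIConn_pull_sub {X Y Y' Z : C} (ε : Val T.E Y Z) (c c' : Y' ⟶ Y)
    (φ : T.NegI 1 X Y') : T.negIConn (pull T.E Z (c - c') ε) X φ =
      T.negIConn (pull T.E Z c ε) X φ - T.negIConn (pull T.E Z c' ε) X φ := by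
  rw [T.pull_sub]
  exact congrArg ULift.down (map_sub (φ.app Z).hom _ _)

theorem negIIConn_push_sub {X X' Y Z : C} (ε : Val T.E Z X) (a a' : X ⟶ X')
    (ψ : T.NegII 1 X' Y) : T.negIIConn (push T.E Z (a - a') ε) Y ψ =
      T.negIIConn (push T.E Z a ε) Y ψ - T.negIIConn (push T.E Z a' ε) Y ψ := by
  rw [T.push_sub]
  exact congrArg ULift.down (map_sub (ψ.app (op Z)).hom _ _)

theorem negIConn_zero {X Y Z : C} (φ : T.NegI 1 X Y) :
    T.negIConn (0 : Val T.E Y Z) X φ = 0 :=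
  congrArg ULift.down (map_zero (φ.app Z).hom)

theorem negIIConn_zero {X Y Z : C} (ψ : T.NegII 1 X Y) :
    T.negIIConn (0 : Val T.E Z X) Y ψ = 0 :=
  congrArg ULift.down (map_zero (ψ.app (op Z)).hom)

theorem IsInjObj.subsingleton_negII {I : C} (hI : T.IsInjObj I) (Y : C) :
    Subsingleton (T.NegII 1 I Y) :=
  ⟨fun ψ ψ' => negII_ext fun Z ε => by rw [hI.val_eq_zero ε, negIIConn_zero, negIIConn_zero]⟩

end Evaluation

/-! ### Negative extensions of degree one in terms of resolutions -/

section Resolution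

variable {T} {Q P Y : C} {q : Q ⟶ P} {p : P ⟶ Y} {ω : Val T.E Y Q}

theorem Triangle.negIConn_comp (h : T.Triangle q p ω) {X : C} (φ : T.NegI 1 X Y) :
    T.negIConn ω X φ ≫ q = 0 := by
  rw [← negIConn_push, h.push_eq_zero, negIConn_zero]

theorem Triangle.negIConn_injective (h : T.Triangle q p ω) (hp : T.IsProjMor p) (X : C) :
    Function.Injective (T.negIConn ω X) := fun φ φ' e => by
  refine negI_ext fun Z ε => ?_
  obtain ⟨a, rfl⟩ := hp.exists_push_eq h ε
  rw [negIConn_push, negIConn_push, e]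

/-- The transformation has to be `a_* ω ↦ s ≫ a`. It is well defined: if `a_* ω = 0`, then `a`
extends along `q`, and `s ≫ q = 0` forces `s ≫ a = 0`. -/
theorem Triangle.exists_negIConn_eq (h : T.Triangle q p ω) (hp : T.IsProjMor p) {X : C}
    (s : X ⟶ Q) (hs : s ≫ q = 0) : ∃ φ : T.NegI 1 X Y, T.negIConn ω X φ = s := by
  have key (Z : C) : ∃ g : Val T.E Y Z →ₗ[R] (X ⟶ Z),
      ∀ a : Q ⟶ Z, g (push T.E Y a ω) = s ≫ a := by
    refine exists_comp_eq_of_ker_le (T.homConnUpper ω Z) (Linear.leftComp R Z s)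
      (hp.exists_push_eq h) fun a ha => ?_
    obtain ⟨b, rfl⟩ := h.exists_extension a ha
    simp [← Category.assoc, hs]
  choose g hg using key
  refine ⟨{ app := fun Z => ModuleCat.ofHom (ULift.moduleEquiv.symm.toLinearMap ∘ₗ g Z ∘ₗ
              ULift.moduleEquiv.toLinearMap)
            naturality := fun Z Z' f => ?_ }, ?_⟩
  · ext ⟨ε⟩
    obtain ⟨a, rfl⟩ := hp.exists_push_eq h ε
    refine congrArg ULift.up ?_
    change g Z' (push T.E Y f (push T.E Y a ω)) = g Z (push T.E Y a ω) ≫ f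
    rw [← push_comp, hg, hg, Category.assoc]
  · have := hg Q (𝟙 Q)
    rw [push_id, Category.comp_id] at this
    exact this

end Resolution

section Coresolution

variable {T} {X I J : C} {i : X ⟶ I} {j : I ⟶ J} {ι : Val T.E J X}

theorem Triangle.comp_negIIConn (h : T.Triangle i j ι) {Y : C} (ψ : T.NegII 1 X Y) :
    j ≫ T.negIIConn ι Y ψ = 0 := by
  rw [← negIIConn_pull, h.pull_eq_zero, negIIConn_zero]

theorem Triangle.negIIConn_injective (h : T.Triangle i j ι) (hi : T.IsInjMor i) (Y : C) :
    Function.Injective (T.negIIConn ι Y) := fun ψ ψ' e => by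
  refine negII_ext fun Z ε => ?_
  obtain ⟨a, rfl⟩ := hi.exists_pull_eq h ε
  rw [negIIConn_pull, negIIConn_pull, e]

theorem Triangle.exists_negIIConn_eq (h : T.Triangle i j ι) (hi : T.IsInjMor i) {Y : C}
    (t : J ⟶ Y) (ht : j ≫ t = 0) : ∃ ψ : T.NegII 1 X Y, T.negIIConn ι Y ψ = t := by
  have key (Z : C) : ∃ g : Val T.E Z X →ₗ[R] (Z ⟶ Y),
      ∀ a : Z ⟶ J, g (pull T.E X a ι) = a ≫ t := by
    refine exists_comp_eq_of_ker_le (T.homConnLower ι Z) (Linear.rightComp R Z t)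
      (hi.exists_pull_eq h) fun a ha => ?_
    obtain ⟨b, rfl⟩ := h.exists_lifting a ha
    simp [ht]
  choose g hg using key
  refine ⟨{ app := fun Z => ModuleCat.ofHom (ULift.moduleEquiv.symm.toLinearMap ∘ₗ g Z.unop ∘ₗ
              ULift.moduleEquiv.toLinearMap)
            naturality := fun Z Z' f => ?_ }, ?_⟩
  · ext ⟨ε⟩
    obtain ⟨a, rfl⟩ := hi.exists_pull_eq h ε
    refine congrArg ULift.up ?_
    change g Z'.unop (pull T.E X f.unop (pull T.E X a ι)) = f.unop ≫ g Z.unop (pull T.E X a ι)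
    rw [← pull_comp, hg, hg, Category.assoc]
  · have := hg J (𝟙 J)
    rw [pull_id, Category.id_comp] at this
    exact this

end Coresolution

section Equivalences

variable {T}

/-- `E_I^{-1}(X, Y)` is the module of the morphisms `X ⟶ Q` annihilated by `Q ⟶ P`, for a
projective resolution `Q ⟶ P ⟶ Y`. -/
noncomputable def negIEquiv {Q P Y : C} {q : Q ⟶ P} {p : P ⟶ Y} {ω : Val T.E Y Q}
    (h : T.Triangle q p ω) (hp : T.IsProjMor p) (X : C) :
    T.NegI 1 X Y ≃ₗ[R] LinearMap.ker (Linear.rightComp R X q) :=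
  LinearEquiv.ofBijective ((T.negIConn ω X).codRestrict _ h.negIConn_comp)
    ⟨fun _ _ e => h.negIConn_injective hp X (congrArg Subtype.val e),
      fun s => (h.exists_negIConn_eq hp s.1 s.2).imp fun _ e => Subtype.ext e⟩

theorem negIConn_negIEquiv_symm {Q P Y : C} {q : Q ⟶ P} {p : P ⟶ Y} {ω : Val T.E Y Q}
    (h : T.Triangle q p ω) (hp : T.IsProjMor p) {X : C}
    (s : LinearMap.ker (Linear.rightComp R X q)) :
    T.negIConn ω X ((negIEquiv h hp X).symm s) = s.1 :=
  congrArg Subtype.val ((negIEquiv h hp X).apply_symm_apply s)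

/-- `E_II^{-1}(X, Y)` is the module of the morphisms `J ⟶ Y` annihilated by `I ⟶ J`, for an
injective coresolution `X ⟶ I ⟶ J`. -/
noncomputable def negIIEquiv {X I J : C} {i : X ⟶ I} {j : I ⟶ J} {ι : Val T.E J X}
    (h : T.Triangle i j ι) (hi : T.IsInjMor i) (Y : C) :
    T.NegII 1 X Y ≃ₗ[R] LinearMap.ker (Linear.leftComp R Y j) :=
  LinearEquiv.ofBijective ((T.negIIConn ι Y).codRestrict _ h.comp_negIIConn)
    ⟨fun _ _ e => h.negIIConn_injective hi Y (congrArg Subtype.val e),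
      fun t => (h.exists_negIIConn_eq hi t.1 t.2).imp fun _ e => Subtype.ext e⟩

theorem negIIConn_negIIEquiv_symm {X I J : C} {i : X ⟶ I} {j : I ⟶ J} {ι : Val T.E J X}
    (h : T.Triangle i j ι) (hi : T.IsInjMor i) {Y : C}
    (t : LinearMap.ker (Linear.leftComp R Y j)) :
    T.negIIConn ι Y ((negIIEquiv h hi Y).symm t) = t.1 :=
  congrArg Subtype.val ((negIIEquiv h hi Y).apply_symm_apply t)

end Equivalences

end ExtriangulatedStructure

end Extri

namespace Extri

/-! ### Comparison of kernels, quotients and cohomologies -/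

section LinearAlgebra

variable {R : Type r} [CommRing R]

theorem nonempty_linearEquiv_of_range_eq {M M' W : Type*} [AddCommGroup M] [AddCommGroup M']
    [AddCommGroup W] [Module R M] [Module R M'] [Module R W] {f : M →ₗ[R] W} {f' : M' →ₗ[R] W}
    (hf : Function.Injective f) (hf' : Function.Injective f')
    (h : LinearMap.range f = LinearMap.range f') : Nonempty (M ≃ₗ[R] M') :=
  ⟨(LinearEquiv.ofInjective f hf).trans
    ((LinearEquiv.ofEq _ _ h).trans (LinearEquiv.ofInjective f' hf').symm)⟩

theorem nonempty_linearEquiv_of_ker_eq {M M' W : Type*} [AddCommGroup M] [AddCommGroup M']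
    [AddCommGroup W] [Module R M] [Module R M'] [Module R W] {f : W →ₗ[R] M} {f' : W →ₗ[R] M'}
    (hf : Function.Surjective f) (hf' : Function.Surjective f')
    (h : LinearMap.ker f = LinearMap.ker f') : Nonempty (M ≃ₗ[R] M') :=
  ⟨(f.quotKerEquivOfSurjective hf).symm.trans
    ((Submodule.quotEquivOfEq _ _ h).trans (f'.quotKerEquivOfSurjective hf'))⟩

section Cohomology

variable {L M N L' M' N' W : Type*} [AddCommGroup L] [AddCommGroup M] [AddCommGroup N]
  [AddCommGroup L'] [AddCommGroup M'] [AddCommGroup N'] [AddCommGroup W] [Module R L]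
  [Module R M] [Module R N] [Module R L'] [Module R M'] [Module R N'] [Module R W]

/-- The map to the cohomology induced by a map to the cocycles. -/
def toCohomology (f : L →ₗ[R] M) (g : M →ₗ[R] N) (k : W →ₗ[R] M) (hk : ∀ x, g (k x) = 0) :
    W →ₗ[R] Cohomology f g :=
  Submodule.mkQ _ ∘ₗ k.codRestrict (LinearMap.ker g) hk

theorem toCohomology_eq_zero_iff (f : L →ₗ[R] M) (g : M →ₗ[R] N) (k : W →ₗ[R] M)
    (hk : ∀ x, g (k x) = 0) (x : W) :
    toCohomology f g k hk x = 0 ↔ ∃ y, f y = k x := by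
  exact Submodule.Quotient.mk_eq_zero _

theorem toCohomology_surjective (f : L →ₗ[R] M) (g : M →ₗ[R] N) (k : W →ₗ[R] M)
    (hk : ∀ x, g (k x) = 0) (h : ∀ m, g m = 0 → ∃ x, k x = m) :
    Function.Surjective (toCohomology f g k hk) := fun z => by
  obtain ⟨⟨m, hm⟩, rfl⟩ := Submodule.mkQ_surjective _ z
  obtain ⟨x, rfl⟩ := h m hm
  exact ⟨x, rfl⟩

/-- A module `W` covering the cocycles of both complexes presents both cohomologies as quotients of
`W`; the last hypothesis says that the kernels agree. -/
theorem nonempty_cohomology_equiv {f : L →ₗ[R] M} {g : M →ₗ[R] N} {f' : L' →ₗ[R] M'}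
    {g' : M' →ₗ[R] N'} (k : W →ₗ[R] M) (k' : W →ₗ[R] M') (hk : ∀ x, g (k x) = 0)
    (hk' : ∀ x, g' (k' x) = 0) (h : ∀ m, g m = 0 → ∃ x, k x = m)
    (h' : ∀ m, g' m = 0 → ∃ x, k' x = m) (hkk' : ∀ x, (∃ y, f y = k x) ↔ ∃ y, f' y = k' x) :
    Nonempty (Cohomology f g ≃ₗ[R] Cohomology f' g') :=
  nonempty_linearEquiv_of_ker_eq (toCohomology_surjective f g k hk h)
    (toCohomology_surjective f' g' k' hk' h') <| by
    ext x
    rw [LinearMap.mem_ker, LinearMap.mem_ker, toCohomology_eq_zero_iff, toCohomology_eq_zero_iff,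
      hkk']

end Cohomology

end LinearAlgebra

namespace ExtriangulatedStructure

variable {R : Type r} [CommRing R] {C : Type u} [Category.{v} C] [Preadditive C] [Linear R C]
  [HasZeroObject C] [HasBinaryBiproducts C] {T : ExtriangulatedStructure.{r, u, v, w} R C}
  {X I J Q P Y : C} {i : X ⟶ I} {j : I ⟶ J} {ι : Val T.E J X}
  {q : Q ⟶ P} {p : P ⟶ Y} {ω : Val T.E Y Q}

/-! ### The two four-term complexes -/

theorem lastI_apply (ι : Val T.E J X) (ω : Val T.E Y Q) (φ : T.NegI 1 X Y) :
    T.lastI ι ω φ = push T.E J (T.negIConn ω X φ) ι := rfl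

theorem lastII_apply (ι : Val T.E J X) (ω : Val T.E Y Q) (ψ : T.NegII 1 X Y) :
    T.lastII ι ω ψ = pull T.E Q (T.negIIConn ι Y ψ) ω := rfl

theorem Triangle.negIPull_comp (h : T.Triangle i j ι) (Y : C) :
    T.negIPull 1 Y i ∘ₗ T.negIPull 1 Y j = 0 := by
  ext1 φ
  refine negI_ext fun Z ε => ?_
  rw [LinearMap.comp_apply, negIConn_negIPull, negIConn_negIPull, ← Category.assoc,
    h.comp_eq_zero, zero_comp, LinearMap.zero_apply, map_zero]

theorem Triangle.negIIPush_comp (h : T.Triangle q p ω) (X : C) :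
    T.negIIPush 1 X p ∘ₗ T.negIIPush 1 X q = 0 := by
  ext1 φ
  refine negII_ext fun Z ε => ?_
  rw [LinearMap.comp_apply, negIIConn_negIIPush, negIIConn_negIIPush, Category.assoc,
    h.comp_eq_zero, comp_zero, LinearMap.zero_apply, map_zero]

theorem Triangle.lastI_comp (h : T.Triangle i j ι) (ω : Val T.E Y Q) :
    T.lastI ι ω ∘ₗ T.negIPull 1 Y i = 0 := by
  ext1 φ
  rw [LinearMap.comp_apply, lastI_apply, negIConn_negIPull, push_comp, h.push_eq_zero, map_zero,
    LinearMap.zero_apply]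

theorem Triangle.lastII_comp (h : T.Triangle q p ω) (ι : Val T.E J X) :
    T.lastII ι ω ∘ₗ T.negIIPush 1 X p = 0 := by
  ext1 φ
  rw [LinearMap.comp_apply, lastII_apply, negIIConn_negIIPush, pull_comp, h.pull_eq_zero, map_zero,
    LinearMap.zero_apply]

variable (hι : T.Triangle i j ι) (hω : T.Triangle q p ω) (hi : T.IsInjMor i) (hp : T.IsProjMor p)

include hι hω hi hp

/-- Both kernels embed in `C(J, Q)` with the same image: the morphisms `s` with `j ≫ s = 0` and `s ≫
q = 0`. -/
theorem nonempty_ker_negIPull_equiv :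
    Nonempty (LinearMap.ker (T.negIPull 1 Y j) ≃ₗ[R] LinearMap.ker (T.negIIPush 1 X q)) := by
  refine nonempty_linearEquiv_of_range_eq
    (f := T.negIConn ω J ∘ₗ (LinearMap.ker (T.negIPull 1 Y j)).subtype)
    (f' := T.negIIConn ι Q ∘ₗ (LinearMap.ker (T.negIIPush 1 X q)).subtype)
    ((hω.negIConn_injective hp J).comp Subtype.val_injective)
    ((hι.negIIConn_injective hi Q).comp Subtype.val_injective) ?_
  ext s
  constructor
  · rintro ⟨⟨φ, hφ⟩, rfl⟩
    have h₁ : j ≫ T.negIConn ω J φ = 0 := by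
      rw [← negIConn_negIPull, LinearMap.mem_ker.1 hφ, map_zero]
    obtain ⟨ψ, hψ⟩ := hι.exists_negIIConn_eq hi _ h₁
    refine ⟨⟨ψ, hι.negIIConn_injective hi P ?_⟩, hψ⟩
    rw [negIIConn_negIIPush, hψ, hω.negIConn_comp, map_zero]
  · rintro ⟨⟨ψ, hψ⟩, rfl⟩
    have h₁ : T.negIIConn ι Q ψ ≫ q = 0 := by
      rw [← negIIConn_negIIPush, LinearMap.mem_ker.1 hψ, map_zero]
    obtain ⟨φ, hφ⟩ := hω.exists_negIConn_eq hp _ h₁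
    refine ⟨⟨φ, hω.negIConn_injective hp I ?_⟩, hφ⟩
    rw [negIConn_negIPull, hφ, hι.comp_negIIConn, map_zero]

/-- The common cover consists of the `x : J ⟶ Q` with `j ≫ x ≫ q = 0`, sent to `j ≫ x` and to `x ≫
q`. Either image is a coboundary exactly when `x` is a sum of a morphism killed by `j` and one
killed by `q`. -/
theorem nonempty_cohomology_negIPull_equiv :
    Nonempty (Cohomology (T.negIPull 1 Y j) (T.negIPull 1 Y i) ≃ₗ[R]
      Cohomology (T.negIIPush 1 X q) (T.negIIPush 1 X p)) := by
  let W := LinearMap.ker (Linear.leftComp R P j ∘ₗ Linear.rightComp R J q)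
  have hW (x : W) : j ≫ x.1 ≫ q = 0 := x.2
  let k : W →ₗ[R] T.NegI 1 I Y := (negIEquiv hω hp I).symm.toLinearMap ∘ₗ
    (Linear.leftComp R Q j ∘ₗ W.subtype).codRestrict (LinearMap.ker (Linear.rightComp R I q))
      fun x => (Category.assoc _ _ _).trans (hW x)
  let k' : W →ₗ[R] T.NegII 1 X P := (negIIEquiv hι hi P).symm.toLinearMap ∘ₗ
    (Linear.rightComp R J q ∘ₗ W.subtype).codRestrict (LinearMap.ker (Linear.leftComp R P j)) hW
  have hk (x : W) : T.negIConn ω I (k x) = j ≫ x.1 := negIConn_negIEquiv_symm hω hp _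
  have hk' (x : W) : T.negIIConn ι P (k' x) = x.1 ≫ q := negIIConn_negIIEquiv_symm hι hi _
  refine nonempty_cohomology_equiv k k' (fun x => ?_) (fun x => ?_) (fun φ hφ => ?_)
    (fun ψ hψ => ?_) fun x => ⟨?_, ?_⟩
  · refine hω.negIConn_injective hp X ?_
    rw [negIConn_negIPull, hk, ← Category.assoc, hι.comp_eq_zero, zero_comp, map_zero]
  · refine hι.negIIConn_injective hi Y ?_
    rw [negIIConn_negIIPush, hk', Category.assoc, hω.comp_eq_zero, comp_zero, map_zero]
  · obtain ⟨s, hs⟩ := hι.exists_desc (T.negIConn ω I φ) (by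
      rw [← negIConn_negIPull, hφ, map_zero])
    have hsW : j ≫ s ≫ q = 0 := by rw [← Category.assoc, hs, hω.negIConn_comp]
    exact ⟨⟨s, hsW⟩, hω.negIConn_injective hp I ((hk _).trans hs)⟩
  · obtain ⟨s, hs⟩ := hω.exists_lift (T.negIIConn ι P ψ) (by
      rw [← negIIConn_negIIPush, hψ, map_zero])
    have hsW : j ≫ s ≫ q = 0 := by rw [hs, hι.comp_negIIConn]
    exact ⟨⟨s, hsW⟩, hι.negIIConn_injective hi P ((hk' _).trans hs)⟩
  · rintro ⟨φ, hφ⟩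
    have h₁ : j ≫ (x.1 - T.negIConn ω J φ) = 0 := by
      rw [Preadditive.comp_sub, ← hk, ← hφ, negIConn_negIPull, sub_self]
    obtain ⟨ψ, hψ⟩ := hι.exists_negIIConn_eq hi _ h₁
    refine ⟨ψ, hι.negIIConn_injective hi P ?_⟩
    rw [negIIConn_negIIPush, hψ, hk', Preadditive.sub_comp, hω.negIConn_comp, sub_zero]
  · rintro ⟨ψ, hψ⟩
    have h₁ : (x.1 - T.negIIConn ι Q ψ) ≫ q = 0 := by
      rw [Preadditive.sub_comp, ← hk', ← hψ, negIIConn_negIIPush, sub_self]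
    obtain ⟨φ, hφ⟩ := hω.exists_negIConn_eq hp _ h₁
    refine ⟨φ, hω.negIConn_injective hp I ?_⟩
    rw [negIConn_negIPull, hφ, hk, Preadditive.comp_sub, hι.comp_negIIConn, sub_zero]

/-- The common cover consists of the commutative squares `s : I ⟶ Q`, `t : J ⟶ P` with `s ≫ q = j ≫
t`, sent to the outer morphisms `i ≫ s : X ⟶ Q` and `t ≫ p : J ⟶ Y`. -/
theorem nonempty_cohomology_lastI_equiv :
    Nonempty (Cohomology (T.negIPull 1 Y i) (T.lastI ι ω) ≃ₗ[R]
      Cohomology (T.negIIPush 1 X p) (T.lastII ι ω)) := by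
  let W := LinearMap.ker ((Linear.rightComp R I q).coprod (-(Linear.leftComp R P j)))
  have hW' (s : I ⟶ Q) (t : J ⟶ P) : (s, t) ∈ W ↔ s ≫ q = j ≫ t := by
    simp [W, LinearMap.mem_ker, ← sub_eq_add_neg, sub_eq_zero]
  have hW (x : W) : x.1.1 ≫ q = j ≫ x.1.2 := (hW' _ _).1 x.2
  let k : W →ₗ[R] T.NegI 1 X Y := (negIEquiv hω hp X).symm.toLinearMap ∘ₗ
    (Linear.leftComp R Q i ∘ₗ LinearMap.fst R _ _ ∘ₗ W.subtype).codRestrict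
      (LinearMap.ker (Linear.rightComp R X q)) fun x => by
        change (i ≫ x.1.1) ≫ q = 0
        rw [Category.assoc, hW, ← Category.assoc, hι.comp_eq_zero, zero_comp]
  let k' : W →ₗ[R] T.NegII 1 X Y := (negIIEquiv hι hi Y).symm.toLinearMap ∘ₗ
    (Linear.rightComp R J p ∘ₗ LinearMap.snd R _ _ ∘ₗ W.subtype).codRestrict
      (LinearMap.ker (Linear.leftComp R Y j)) fun x => by
        change j ≫ x.1.2 ≫ p = 0
        rw [← Category.assoc, ← hW, Category.assoc, hω.comp_eq_zero, comp_zero]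
  have hk (x : W) : T.negIConn ω X (k x) = i ≫ x.1.1 := negIConn_negIEquiv_symm hω hp _
  have hk' (x : W) : T.negIIConn ι Y (k' x) = x.1.2 ≫ p := negIIConn_negIIEquiv_symm hι hi _
  refine nonempty_cohomology_equiv k k' (fun x => ?_) (fun x => ?_) (fun φ hφ => ?_)
    (fun ψ hψ => ?_) fun x => ⟨?_, ?_⟩
  · rw [lastI_apply, hk, push_comp, hι.push_eq_zero, map_zero]
  · rw [lastII_apply, hk', pull_comp, hω.pull_eq_zero, map_zero]
  · obtain ⟨s, hs⟩ := hι.exists_extension _ hφ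
    obtain ⟨t, ht⟩ := hι.exists_desc (s ≫ q) (by rw [← Category.assoc, hs, hω.negIConn_comp])
    exact ⟨⟨(s, t), (hW' s t).2 ht.symm⟩, hω.negIConn_injective hp X ((hk _).trans hs)⟩
  · obtain ⟨t, ht⟩ := hω.exists_lifting _ hψ
    obtain ⟨s, hs⟩ := hω.exists_lift (j ≫ t) (by rw [Category.assoc, ht, hι.comp_negIIConn])
    exact ⟨⟨(s, t), (hW' s t).2 hs⟩, hι.negIIConn_injective hi Y ((hk' _).trans ht)⟩
  · rintro ⟨φ, hφ⟩
    -- The diagonal `a : J ⟶ Q` is a homotopy: replacing `t` by `t - a ≫ q` leaves `t ≫ p` unchanged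
    -- and makes the morphism vanish on `j`.
    obtain ⟨a, ha⟩ := hι.exists_desc (x.1.1 - T.negIConn ω I φ) (by
      rw [Preadditive.comp_sub, ← hk, ← hφ, negIConn_negIPull, sub_self])
    obtain ⟨ψ, hψ⟩ := hι.exists_negIIConn_eq hi (x.1.2 - a ≫ q) (by
      rw [Preadditive.comp_sub, ← hW, ← Category.assoc, ha, Preadditive.sub_comp,
        hω.negIConn_comp, sub_zero, sub_self])
    refine ⟨ψ, hι.negIIConn_injective hi Y ?_⟩
    rw [negIIConn_negIIPush, hψ, hk', Preadditive.sub_comp, Category.assoc, hω.comp_eq_zero,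
      comp_zero, sub_zero]
  · rintro ⟨ψ, hψ⟩
    obtain ⟨a, ha⟩ := hω.exists_lift (x.1.2 - T.negIIConn ι P ψ) (by
      rw [Preadditive.sub_comp, ← hk', ← hψ, negIIConn_negIIPush, sub_self])
    obtain ⟨φ, hφ⟩ := hω.exists_negIConn_eq hp (x.1.1 - j ≫ a) (by
      rw [Preadditive.sub_comp, hW, Category.assoc, ha, Preadditive.comp_sub,
        hι.comp_negIIConn, sub_zero, sub_self])
    refine ⟨φ, hω.negIConn_injective hp X ?_⟩
    rw [negIConn_negIPull, hφ, hk, Preadditive.comp_sub, ← Category.assoc, hι.comp_eq_zero,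
      zero_comp, sub_zero]

/-- If `s : X ⟶ Q` satisfies `s ≫ q = 0`, then `(s, 0)` is a commutative square from `i` to `q`;
(ET3) completes it by some `t : J ⟶ Y` with `s_* ι = t^* ω` and `j ≫ t = 0`. The other inclusion is
dual. -/
theorem range_lastI_eq_range_lastII :
    LinearMap.range (T.lastI ι ω) = LinearMap.range (T.lastII ι ω) := by
  ext ε
  constructor
  · rintro ⟨φ, rfl⟩
    obtain ⟨t, ht, hjt⟩ := T.et3 ι ω i j q p hι hω (T.negIConn ω X φ) 0 (by
      rw [comp_zero, hω.negIConn_comp])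
    obtain ⟨ψ, rfl⟩ := hι.exists_negIIConn_eq hi t (by rw [hjt, zero_comp])
    exact ⟨ψ, ht.symm⟩
  · rintro ⟨ψ, rfl⟩
    obtain ⟨s, hs, hsq⟩ := T.et3_op ι ω i j q p hι hω 0 (T.negIIConn ι Y ψ) (by
      rw [zero_comp, hι.comp_negIIConn])
    obtain ⟨φ, rfl⟩ := hω.exists_negIConn_eq hp s (by rw [← hsq, comp_zero])
    exact ⟨φ, hs⟩

end ExtriangulatedStructure

end Extri

namespace Extri

/-! ### Tensor products of functors -/

section Coend

variable {R : Type r} [CommRing R] {C : Type u} [Category.{v} C]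
  (G : Cᵒᵖ ⥤ ModuleCat.{max u v w} R) (F : C ⥤ ModuleCat.{w} R)

/-- The tensor product `G ⊗ F = ∫^M G(M) ⊗ F(M)` of functors. -/
noncomputable abbrev functorTensor : ModuleCat.{max u v w} R :=
  coend (tensorBifunctor.{r, u, v, w, max u v w} G F)

/-- The class of `g ⊗ x` in `∫^M G(M) ⊗ F(M)`. -/
noncomputable def coendMk (M : C) :
    G.obj (op M) →ₗ[R] F.obj M →ₗ[R] functorTensor G F :=
  (TensorProduct.mk R (G.obj (op M)) (F.obj M)).compr₂ (coend.ι (tensorBifunctor G F) M).hom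

variable {G F}

theorem coendMk_map {M M' : C} (f : M ⟶ M') (g : G.obj (op M')) (x : F.obj M) :
    coendMk G F M ((G.map f.op).hom g) x = coendMk G F M' g ((F.map f).hom x) :=
  congrArg (fun h => h.hom (g ⊗ₜ[R] x)) (coend.condition (tensorBifunctor G F) f)

theorem functorTensor_hom_ext {N : ModuleCat.{max u v w} R} {f g : functorTensor G F ⟶ N}
    (h : ∀ (M : C) (y : G.obj (op M)) (x : F.obj M),
      f.hom (coendMk G F M y x) = g.hom (coendMk G F M y x)) : f = g := by
  refine coend.hom_ext fun M => ?_
  ext1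
  exact TensorProduct.ext' (h M)

/-- The quotient map by `S` vanishes on the classes of pure tensors, hence is zero by the universal
property of the coend. -/
theorem functorTensor_submodule_eq_top (S : Submodule R (functorTensor G F))
    (h : ∀ (M : C) (y : G.obj (op M)) (x : F.obj M), coendMk G F M y x ∈ S) : S = ⊤ := by
  have : ModuleCat.ofHom S.mkQ = 0 := functorTensor_hom_ext fun M y x =>
    (Submodule.Quotient.mk_eq_zero S).2 (h M y x)
  rw [← S.ker_mkQ]
  exact LinearMap.ker_eq_top.2 (congrArg ModuleCat.Hom.hom this)

theorem exists_functorTensor_desc {N : Type (max u v w)} [AddCommGroup N] [Module R N]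
    (β : ∀ M : C, G.obj (op M) →ₗ[R] F.obj M →ₗ[R] N)
    (hβ : ∀ {M M' : C} (f : M ⟶ M') (y : G.obj (op M')) (x : F.obj M),
      β M ((G.map f.op).hom y) x = β M' y ((F.map f).hom x)) :
    ∃ h : functorTensor G F →ₗ[R] N, ∀ M y x, h (coendMk G F M y x) = β M y x := by
  let d : functorTensor G F ⟶ ModuleCat.of R N :=
    coend.desc (F := tensorBifunctor G F)
      (fun M => ModuleCat.ofHom (TensorProduct.lift (β M))) fun M M' f => by
        ext1
        exact TensorProduct.ext' (hβ f)
  refine ⟨d.hom, fun M y x => ?_⟩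
  have := coend.ι_desc (F := tensorBifunctor G F) (X := ModuleCat.of R N)
      (fun M => ModuleCat.ofHom (TensorProduct.lift (β M))) (fun M M' f => by
        ext1
        exact TensorProduct.ext' (hβ f)) M
  exact congrArg (fun h => h.hom (y ⊗ₜ[R] x)) this

/-- If `ω` generates `F`, every pure tensor moves to the object `Q`: `y ⊗ a_* ω = a^* y ⊗ ω`. -/
theorem coendMk_surjective_left {Q : C} (ω : F.obj Q)
    (hω : ∀ (M : C) (x : F.obj M), ∃ a : Q ⟶ M, (F.map a).hom ω = x) (z : functorTensor G F) :
    ∃ y, coendMk G F Q y ω = z := by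
  have : LinearMap.range ((coendMk G F Q).flip ω) = ⊤ :=
    functorTensor_submodule_eq_top _ fun M y x => by
      obtain ⟨a, rfl⟩ := hω M x
      exact ⟨_, coendMk_map a y ω⟩
  exact LinearMap.range_eq_top.1 this z

theorem coendMk_surjective_right {J : C} (ι : G.obj (op J))
    (hι : ∀ (M : C) (y : G.obj (op M)), ∃ c : M ⟶ J, (G.map c.op).hom ι = y)
    (z : functorTensor G F) : ∃ x, coendMk G F J ι x = z := by
  have : LinearMap.range (coendMk G F J ι) = ⊤ :=
    functorTensor_submodule_eq_top _ fun M y x => by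
      obtain ⟨a, rfl⟩ := hι M y
      exact ⟨_, (coendMk_map a ι x).symm⟩
  exact LinearMap.range_eq_top.1 this z

variable [Preadditive C] [Linear R C]

/-- Right exactness of `G ⊗ -`: a presentation `C(P, -) ⟶ C(Q, -) ⟶ F ⟶ 0` gives exactness of `G(P)
⟶ G(Q) ⟶ G ⊗ F ⟶ 0`. The proof constructs the inverse `G ⊗ F ⟶ G(Q) / im q^*`, `y ⊗ a_* ω ↦ [a^*
y]`. -/
theorem exists_map_eq_of_coendMk_eq_zero_left {Q P : C} (ω : F.obj Q) (q : Q ⟶ P)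
    (hω : ∀ (M : C) (x : F.obj M), ∃ a : Q ⟶ M, (F.map a).hom ω = x)
    (hq : ∀ {M : C} (a : Q ⟶ M), (F.map a).hom ω = 0 → ∃ b : P ⟶ M, q ≫ b = a)
    (hF : ∀ {M : C} (a a' : Q ⟶ M),
      (F.map (a + a')).hom ω = (F.map a).hom ω + (F.map a').hom ω)
    (hF' : ∀ {M : C} (t : R) (a : Q ⟶ M), (F.map (t • a)).hom ω = t • (F.map a).hom ω)
    (hG : ∀ {M : C} (a a' : Q ⟶ M) (y : G.obj (op M)),
      (G.map (a + a').op).hom y = (G.map a.op).hom y + (G.map a'.op).hom y)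
    (hG' : ∀ {M : C} (t : R) (a : Q ⟶ M) (y : G.obj (op M)),
      (G.map (t • a).op).hom y = t • (G.map a.op).hom y)
    (y : G.obj (op Q)) (hy : coendMk G F Q y ω = 0) : ∃ y', (G.map q.op).hom y' = y := by
  let S : Submodule R (G.obj (op Q)) := LinearMap.range (G.map q.op).hom
  -- If `a` and `a'` agree on `ω`, their difference is `q ≫ b`, which moves `y` into the image of
  -- `q^*`. Hence the arbitrary choice `σ` below is bilinear and balanced modulo `S`.
  have key {M : C} (a a' : Q ⟶ M) (h : (F.map a).hom ω = (F.map a').hom ω) (y : G.obj (op M)) :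
      S.mkQ ((G.map a.op).hom y) = S.mkQ ((G.map a'.op).hom y) := by
    have h₁ := hF (a - a') a'
    rw [sub_add_cancel, h, right_eq_add] at h₁
    obtain ⟨b, hb⟩ := hq _ h₁
    have h₂ := hG (a - a') a' y
    rw [sub_add_cancel] at h₂
    rw [h₂, map_add, add_eq_right]
    refine (Submodule.Quotient.mk_eq_zero S).2 ⟨(G.map b.op).hom y, ?_⟩
    rw [← hb, op_comp, G.map_comp]
    rfl
  choose σ hσ using hω
  obtain ⟨h, hh⟩ := exists_functorTensor_desc (G := G) (F := F) (N := G.obj (op Q) ⧸ S)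
    (fun M => LinearMap.mk₂ R (fun y x => S.mkQ ((G.map (σ M x).op).hom y))
      (fun _ _ _ => by rw [map_add, map_add]) (fun _ _ _ => by rw [map_smul, map_smul])
      (fun y x x' => by
        rw [key (σ M (x + x')) (σ M x + σ M x') (by rw [hF, hσ, hσ, hσ]), hG, map_add])
      (fun t y x => by
        rw [key (σ M (t • x)) (t • σ M x) (by rw [hF', hσ, hσ]), hG', map_smul]))
    (fun {M M'} f y x => by
      refine Eq.trans ?_ (key (σ M x ≫ f) (σ M' ((F.map f).hom x)) ?_ y)
      · rw [op_comp, G.map_comp]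
        rfl
      · rw [hσ, F.map_comp, ModuleCat.comp_apply, hσ])
  have h₁ := hh Q y ω
  rw [hy, map_zero] at h₁
  have h₂ := key (σ Q ω) (𝟙 Q) (by rw [hσ, F.map_id]; rfl) y
  rw [op_id, G.map_id] at h₂
  exact (Submodule.Quotient.mk_eq_zero S).1 (h₂.symm.trans h₁.symm)

theorem exists_map_eq_of_coendMk_eq_zero_right {I J : C} (ι : G.obj (op J)) (j : I ⟶ J)
    (hι : ∀ (M : C) (y : G.obj (op M)), ∃ c : M ⟶ J, (G.map c.op).hom ι = y)
    (hj : ∀ {M : C} (c : M ⟶ J), (G.map c.op).hom ι = 0 → ∃ b : M ⟶ I, b ≫ j = c)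
    (hG : ∀ {M : C} (c c' : M ⟶ J),
      (G.map (c + c').op).hom ι = (G.map c.op).hom ι + (G.map c'.op).hom ι)
    (hG' : ∀ {M : C} (t : R) (c : M ⟶ J), (G.map (t • c).op).hom ι = t • (G.map c.op).hom ι)
    (hF : ∀ {M : C} (c c' : M ⟶ J) (x : F.obj M),
      (F.map (c + c')).hom x = (F.map c).hom x + (F.map c').hom x)
    (hF' : ∀ {M : C} (t : R) (c : M ⟶ J) (x : F.obj M),
      (F.map (t • c)).hom x = t • (F.map c).hom x)
    (x : F.obj J) (hx : coendMk G F J ι x = 0) : ∃ x', (F.map j).hom x' = x := by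
  let S : Submodule R (F.obj J) := LinearMap.range (F.map j).hom
  have key {M : C} (c c' : M ⟶ J) (h : (G.map c.op).hom ι = (G.map c'.op).hom ι)
      (x : F.obj M) : S.mkQ ((F.map c).hom x) = S.mkQ ((F.map c').hom x) := by
    have h₁ := hG (c - c') c'
    rw [sub_add_cancel, h, right_eq_add] at h₁
    obtain ⟨b, hb⟩ := hj _ h₁
    have h₂ := hF (c - c') c' x
    rw [sub_add_cancel] at h₂
    rw [h₂, map_add, add_eq_right]
    refine (Submodule.Quotient.mk_eq_zero S).2 ⟨(F.map b).hom x, ?_⟩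
    rw [← hb, F.map_comp]
    rfl
  choose σ hσ using hι
  -- The quotient of `F.obj J` lives in the universe `w` and is lifted to the universe of the coend.
  obtain ⟨h, hh⟩ := exists_functorTensor_desc (G := G) (F := F)
    (N := ULift.{max u v} (F.obj J ⧸ S))
    (fun M => (LinearMap.mk₂ R (fun y x => S.mkQ ((F.map (σ M y)).hom x))
      (fun y y' x => by
        rw [key (σ M (y + y')) (σ M y + σ M y') (by rw [hG, hσ, hσ, hσ]), hF, map_add])
      (fun t y x => by
        rw [key (σ M (t • y)) (t • σ M y) (by rw [hG', hσ, hσ]), hF', map_smul])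
      (fun _ _ _ => by rw [map_add, map_add]) (fun _ _ _ => by rw [map_smul, map_smul])).compr₂
        ULift.moduleEquiv.symm.toLinearMap)
    (fun {M M'} f y x => by
      refine congrArg ULift.up (Eq.trans (key (σ M ((G.map f.op).hom y)) (f ≫ σ M' y) ?_ x) ?_)
      · rw [hσ, op_comp, G.map_comp, ModuleCat.comp_apply, hσ]
      · rw [F.map_comp]
        rfl)
  have h₁ := hh J ι x
  rw [hx, map_zero] at h₁
  have h₂ := key (σ J ι) (𝟙 J) (by rw [hσ, op_id, G.map_id]; rfl) x
  rw [F.map_id] at h₂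
  exact (Submodule.Quotient.mk_eq_zero S).1 (h₂.symm.trans (congrArg ULift.down h₁.symm))

end Coend

end Extri

namespace Extri

/-! ### Transformations out of pointwise cokernels -/

section Cokernel

variable {R : Type r} [CommRing R] {D : Type u} [Category.{v} D] {K A B : D ⥤ ModuleCat.{w} R}

/-- Transformations out of a pointwise cokernel of `κ` are the transformations that vanish
on `κ`. -/
theorem nonempty_hom_equiv_ker_leftComp (κ : K ⟶ A) (π : A ⟶ B) (H : D ⥤ ModuleCat.{w} R)
    (hκπ : κ ≫ π = 0) (hπ : ∀ Z, Function.Surjective (π.app Z).hom)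
    (hπκ : ∀ Z (y : A.obj Z), (π.app Z).hom y = 0 → ∃ y', (κ.app Z).hom y' = y) :
    Nonempty ((B ⟶ H) ≃ₗ[R] LinearMap.ker (Linear.leftComp R H κ)) := by
  refine ⟨LinearEquiv.ofBijective ((Linear.leftComp R H π).codRestrict _ fun φ => ?_)
    ⟨fun φ φ' e => ?_, fun ⟨φ, hφ⟩ => ?_⟩⟩
  · change κ ≫ π ≫ φ = 0
    rw [← Category.assoc, hκπ, zero_comp]
  · ext Z z
    obtain ⟨y, rfl⟩ := hπ Z z
    exact congrArg (fun f : A ⟶ H => (f.app Z).hom y) (congrArg Subtype.val e)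
  · have hφ' (Z : D) (y : A.obj Z) (hy : (π.app Z).hom y = 0) : (φ.app Z).hom y = 0 := by
      obtain ⟨y', rfl⟩ := hπκ Z y hy
      exact congrArg (fun f : K ⟶ H => (f.app Z).hom y') hφ
    choose g hg using fun Z => exists_comp_eq_of_ker_le _ _ (hπ Z) (hφ' Z)
    refine ⟨{ app := fun Z => ModuleCat.ofHom (g Z), naturality := fun Z Z' f => ?_ }, ?_⟩
    · ext z
      obtain ⟨y, rfl⟩ := hπ Z z
      have h₁ := congrArg (fun h => h.hom y) (π.naturality f)
      have h₂ := congrArg (fun h => h.hom y) (φ.naturality f)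
      refine (congrArg (g Z') h₁.symm).trans ((hg Z' _).trans (h₂.trans ?_))
      exact congrArg (H.map f).hom (hg Z y).symm
    · refine Subtype.ext ?_
      ext Z y
      exact hg Z y

end Cokernel

/-- An isomorphism `G ≅ G'` induces an isomorphism `G ⊗ F ≅ G' ⊗ F`. -/
noncomputable def functorTensorIso {R : Type r} [CommRing R] {C : Type u} [Category.{v} C]
    {G G' : Cᵒᵖ ⥤ ModuleCat.{max u v w} R} (e : G ≅ G') (F : C ⥤ ModuleCat.{w} R) :
    functorTensor G F ≅ functorTensor G' F where
  hom := coend.map (tensorBifunctorMap e.hom (𝟙 F))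
  inv := coend.map (tensorBifunctorMap e.inv (𝟙 F))
  hom_inv_id := by
    rw [coend.map_comp, tensorBifunctorMap_comp, e.hom_inv_id, Category.comp_id,
      tensorBifunctorMap_id, coend.map_id]
  inv_hom_id := by
    rw [coend.map_comp, tensorBifunctorMap_comp, e.inv_hom_id, Category.comp_id,
      tensorBifunctorMap_id, coend.map_id]

namespace ExtriangulatedStructure

variable {R : Type r} [CommRing R] {C : Type u} [Category.{v} C] [Preadditive C] [Linear R C]
  [HasZeroObject C] [HasBinaryBiproducts C] (T : ExtriangulatedStructure.{r, u, v, w} R C)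

/-! ### Higher extensions in terms of resolutions -/

/-- The class of `y ⊗ x` in `E^{n+2}(X, Z)`, for `y ∈ E^{n+1}(M, Z)` and `x ∈ E(X, M)`. -/
noncomputable abbrev extMk (n : ℕ) {X Z M : C} (y : ((T.Ext (n + 1)).obj (op M)).obj Z)
    (x : Val T.E X M) : ((T.Ext (n + 2)).obj (op X)).obj Z :=
  coendMk ((T.Ext (n + 1)).flip.obj Z) (T.E.obj (op X)) M y x

theorem ext_map_extMk (n : ℕ) {X X' Z M : C} (c : X' ⟶ X)
    (y : ((T.Ext (n + 1)).obj (op M)).obj Z) (x : Val T.E X M) :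
    (((T.Ext (n + 2)).map c.op).app Z).hom (T.extMk n y x) = T.extMk n y (pull T.E M c x) :=
  congrArg (fun h => h.hom (y ⊗ₜ[R] x)) (coend.ι_map (tensorBifunctorMap
    (𝟙 ((T.Ext (n + 1)).flip.obj Z)) (T.E.map c.op)) M)

theorem ext_obj_map_extMk (n : ℕ) {X Z Z' M : C} (a : Z ⟶ Z')
    (y : ((T.Ext (n + 1)).obj (op M)).obj Z) (x : Val T.E X M) :
    (((T.Ext (n + 2)).obj (op X)).map a).hom (T.extMk n y x) =
      T.extMk n ((((T.Ext (n + 1)).obj (op M)).map a).hom y) x :=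
  congrArg (fun h => h.hom (y ⊗ₜ[R] x)) (coend.ι_map (tensorBifunctorMap
    ((T.Ext (n + 1)).flip.map a) (𝟙 (T.E.obj (op X)))) M)

/-- In `E^{n+2}` the morphism acts only on the factor `E` of a pure tensor, so additivity of `E`
suffices. The right exactness lemmas take this as input. -/
theorem ext_map_add (n : ℕ) {X X' Z : C} (c c' : X' ⟶ X)
    (y : ((T.Ext (n + 1)).obj (op X)).obj Z) :
    (((T.Ext (n + 1)).map (c + c').op).app Z).hom y =
      (((T.Ext (n + 1)).map c.op).app Z).hom y + (((T.Ext (n + 1)).map c'.op).app Z).hom y := by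
  cases n with
  | zero => exact congrArg ULift.up (T.pull_add Z c c' y.down)
  | succ n =>
    refine congrArg (fun h => h.hom y) (functorTensor_hom_ext
      (f := ((T.Ext (n + 2)).map (c + c').op).app Z)
      (g := ((T.Ext (n + 2)).map c.op).app Z + ((T.Ext (n + 2)).map c'.op).app Z)
      fun M y x => ?_)
    refine (T.ext_map_extMk n (c + c') y x).trans ?_
    refine (congrArg (T.extMk n y) (T.pull_add M c c' x)).trans ?_
    refine (map_add (coendMk ((T.Ext (n + 1)).flip.obj Z) (T.E.obj (op X')) M y) _ _).trans ?_
    exact congrArg₂ (· + ·) (T.ext_map_extMk n c y x).symm (T.ext_map_extMk n c' y x).symm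

theorem ext_map_smul (n : ℕ) {X X' Z : C} (t : R) (c : X' ⟶ X)
    (y : ((T.Ext (n + 1)).obj (op X)).obj Z) :
    (((T.Ext (n + 1)).map (t • c).op).app Z).hom y =
      t • (((T.Ext (n + 1)).map c.op).app Z).hom y := by
  cases n with
  | zero => exact congrArg ULift.up (T.pull_smul Z t c y.down)
  | succ n =>
    refine congrArg (fun h => h.hom y) (functorTensor_hom_ext
      (f := ((T.Ext (n + 2)).map (t • c).op).app Z)
      (g := t • ((T.Ext (n + 2)).map c.op).app Z) fun M y x => ?_)
    refine (T.ext_map_extMk n (t • c) y x).trans ?_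
    refine (congrArg (T.extMk n y) (T.pull_smul M t c x)).trans ?_
    refine (map_smul (coendMk ((T.Ext (n + 1)).flip.obj Z) (T.E.obj (op X')) M y) _ _).trans ?_
    exact congrArg (t • ·) (T.ext_map_extMk n c y x).symm

/-- The transformation `E^{n+1}(Q, -) ⟶ E^{n+2}(Y, -)` given by `ω ∈ E(Y, Q)`. -/
noncomputable def extConnUpper (n : ℕ) {Y Q : C} (ω : Val T.E Y Q) :
    (T.Ext (n + 1)).obj (op Q) ⟶ (T.Ext (n + 2)).obj (op Y) where
  app Z := ModuleCat.ofHom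
    ((coendMk ((T.Ext (n + 1)).flip.obj Z) (T.E.obj (op Y)) Q).flip ω)
  naturality Z Z' a := by
    ext y
    exact (T.ext_obj_map_extMk n a y ω).symm

/-- The transformation `E(-, J) ⟶ E^2(-, X)` given by `ι ∈ E(J, X)`. -/
noncomputable def extConnLower {J X : C} (ι : Val T.E J X) :
    (T.Ext 1).flip.obj J ⟶ (T.Ext 2).flip.obj X where
  app Z := ModuleCat.ofHom
    (coendMk ((T.Ext 1).flip.obj X) (T.E.obj Z) J (ULift.up ι) ∘ₗ
      ULift.moduleEquiv.toLinearMap)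
  naturality Z Z' c := by
    ext ⟨y⟩
    exact (T.ext_map_extMk 0 c.unop (ULift.up ι) y).symm

section Resolution

variable {T} {Q P Y : C} {q : Q ⟶ P} {p : P ⟶ Y} {ω : Val T.E Y Q}

theorem extConnUpper_surjective (h : T.Triangle q p ω) (hp : T.IsProjMor p) (n : ℕ) (Z : C) :
    Function.Surjective ((T.extConnUpper n ω).app Z).hom :=
  coendMk_surjective_left (F := T.E.obj (op Y)) ω fun _ x => hp.exists_push_eq h x

theorem exists_map_eq_of_extConnUpper_eq_zero (h : T.Triangle q p ω) (hp : T.IsProjMor p)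
    (n : ℕ) (Z : C) (y : ((T.Ext (n + 1)).obj (op Q)).obj Z)
    (hy : ((T.extConnUpper n ω).app Z).hom y = 0) :
    ∃ y', (((T.Ext (n + 1)).map q.op).app Z).hom y' = y :=
  exists_map_eq_of_coendMk_eq_zero_left (G := (T.Ext (n + 1)).flip.obj Z)
    (F := T.E.obj (op Y)) ω q (fun _ x => hp.exists_push_eq h x) (h.exists_extension ·)
    (fun a a' => T.push_add Y a a' ω) (fun t a => T.push_smul Y t a ω)
    (fun a a' => T.ext_map_add n a a') (fun t a => T.ext_map_smul n t a) y hy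

theorem Triangle.map_comp_extConnUpper (h : T.Triangle q p ω) (n : ℕ) :
    (T.Ext (n + 1)).map q.op ≫ T.extConnUpper n ω = 0 := by
  ext Z y
  refine (coendMk_map (G := (T.Ext (n + 1)).flip.obj Z) (F := T.E.obj (op Y)) q y ω).trans ?_
  exact (congrArg (T.extMk n y) h.push_eq_zero).trans (map_zero _)

/-- `E_I^{-(n+2)}(X, Y)` is the kernel of `E_I^{-(n+1)}(X, Q) ⟶ E_I^{-(n+1)}(X, P)`. -/
theorem nonempty_negI_equiv_ker (h : T.Triangle q p ω) (hp : T.IsProjMor p) (n : ℕ) (X : C) :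
    Nonempty (T.NegI (n + 2) X Y ≃ₗ[R] LinearMap.ker (T.negIPush (n + 1) X q)) :=
  nonempty_hom_equiv_ker_leftComp _ _ _ (h.map_comp_extConnUpper n)
    (extConnUpper_surjective h hp n) (exists_map_eq_of_extConnUpper_eq_zero h hp n)

theorem IsProjObj.subsingleton_ext (hP : T.IsProjObj P) (n : ℕ) (Z : C) :
    Subsingleton (((T.Ext (n + 1)).obj (op P)).obj Z) := by
  have := fun M => subsingleton_of_forall_eq (0 : Val T.E P M) hP.val_eq_zero
  cases n with
  | zero => exact Equiv.ulift.subsingleton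
  | succ n =>
    refine (Submodule.subsingleton_iff R).1 (subsingleton_of_bot_eq_top ?_)
    refine functorTensor_submodule_eq_top _ fun M y x => ?_
    have hx : x = 0 := hP.val_eq_zero x
    rw [hx, map_zero]
    exact Submodule.zero_mem _

theorem IsProjObj.subsingleton_negI (hP : T.IsProjObj P) (n : ℕ) (X : C) :
    Subsingleton (T.NegI (n + 1) X P) :=
  ⟨fun φ φ' => by
    ext Z y
    have := hP.subsingleton_ext n Z
    rw [Subsingleton.elim y 0, map_zero, map_zero]⟩

/-- Dimension shift along a resolution by a projective object. -/
theorem nonempty_negI_equiv (h : T.Triangle q p ω) (hP : T.IsProjObj P) (n : ℕ) (X : C) :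
    Nonempty (T.NegI (n + 2) X Y ≃ₗ[R] T.NegI (n + 1) X Q) := by
  obtain ⟨e⟩ := nonempty_negI_equiv_ker h (hP.isProjMor p) n X
  have := hP.subsingleton_negI n X
  exact ⟨e.trans (LinearEquiv.ofTop _ (LinearMap.ker_eq_top.2
    (LinearMap.ext fun _ => Subsingleton.elim _ _)))⟩

end Resolution

section Coresolution

variable {T} {X I J : C} {i : X ⟶ I} {j : I ⟶ J} {ι : Val T.E J X}

theorem extConnLower_surjective (h : T.Triangle i j ι) (hi : T.IsInjMor i) (Z : Cᵒᵖ) :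
    Function.Surjective ((T.extConnLower ι).app Z).hom := fun z => by
  obtain ⟨x, hx⟩ := coendMk_surjective_right (G := (T.Ext 1).flip.obj X)
    (F := T.E.obj Z) (ULift.up ι)
    (fun M y => (hi.exists_pull_eq h y.down).imp fun _ e => congrArg ULift.up e) z
  exact ⟨ULift.up x, hx⟩

theorem exists_map_eq_of_extConnLower_eq_zero (h : T.Triangle i j ι) (hi : T.IsInjMor i)
    (Z : Cᵒᵖ) (x : ((T.Ext 1).flip.obj J).obj Z)
    (hx : ((T.extConnLower ι).app Z).hom x = 0) :
    ∃ x', (((T.Ext 1).flip.map j).app Z).hom x' = x := by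
  obtain ⟨x', hx'⟩ := exists_map_eq_of_coendMk_eq_zero_right (G := (T.Ext 1).flip.obj X)
    (F := T.E.obj Z) (ULift.up ι) j
    (fun M y => (hi.exists_pull_eq h y.down).imp fun _ e => congrArg ULift.up e)
    (fun c hc => h.exists_lifting c (congrArg ULift.down hc))
    (fun c c' => T.ext_map_add 0 c c' (ULift.up ι)) (fun t c => T.ext_map_smul 0 t c (ULift.up ι))
    (fun a a' => T.push_add Z.unop a a') (fun t a => T.push_smul Z.unop t a) x.down hx
  exact ⟨ULift.up x', congrArg ULift.up hx'⟩

theorem Triangle.map_comp_extConnLower (h : T.Triangle i j ι) :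
    (T.Ext 1).flip.map j ≫ T.extConnLower ι = 0 := by
  ext Z ⟨x⟩
  refine (coendMk_map (G := (T.Ext 1).flip.obj X) (F := T.E.obj Z) j (ULift.up ι) x).symm.trans ?_
  have : (((T.Ext 1).flip.obj X).map j.op).hom (ULift.up ι) = 0 :=
    congrArg ULift.up h.pull_eq_zero
  rw [this, map_zero]
  rfl

/-- `E_II^{-2}(X, Y)` is the kernel of `E_II^{-1}(J, Y) ⟶ E_II^{-1}(I, Y)`. -/
theorem nonempty_negII_equiv_ker (h : T.Triangle i j ι) (hi : T.IsInjMor i) (Y : C) :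
    Nonempty (T.NegII 2 X Y ≃ₗ[R] LinearMap.ker (T.negIIPull 1 Y j)) :=
  nonempty_hom_equiv_ker_leftComp _ _ _ h.map_comp_extConnLower
    (extConnLower_surjective h hi) (exists_map_eq_of_extConnLower_eq_zero h hi)

/-- An isomorphism `E^{n+1}(-, J) ≅ E^{m+1}(-, X)` induces an isomorphism
`E^{n+2}(-, J) ≅ E^{m+2}(-, X)`. -/
noncomputable def extSuccIso {n m : ℕ} {J X : C}
    (e : (T.Ext (n + 1)).flip.obj J ≅ (T.Ext (m + 1)).flip.obj X) :
    (T.Ext (n + 2)).flip.obj J ≅ (T.Ext (m + 2)).flip.obj X :=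
  NatIso.ofComponents (fun Z => functorTensorIso e (T.E.obj Z)) fun {Z Z'} c => by
    refine (coend.map_comp _ _).trans (Eq.trans ?_ (coend.map_comp _ _).symm)
    rw [tensorBifunctorMap_comp, tensorBifunctorMap_comp, Category.comp_id, Category.id_comp,
      Category.id_comp, Category.comp_id]

/-- The recursion splits off `E` on the side of the first variable, so a coresolution of the second
variable acts directly only on `E^2`. There the connecting map is bijective because `E(-, I) = 0`;
higher degrees follow by composing with `E`. -/
theorem nonempty_ext_iso (h : T.Triangle i j ι) (hI : T.IsInjObj I) (n : ℕ) :
    Nonempty ((T.Ext (n + 1)).flip.obj J ≅ (T.Ext (n + 2)).flip.obj X) := by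
  induction n with
  | zero =>
    have (Z : Cᵒᵖ) : IsIso ((T.extConnLower ι).app Z) := by
      rw [ConcreteCategory.isIso_iff_bijective]
      refine ⟨(injective_iff_map_eq_zero ((T.extConnLower ι).app Z).hom).2 fun x hx => ?_,
        extConnLower_surjective h (hI.isInjMor i) Z⟩
      obtain ⟨⟨y⟩, rfl⟩ := exists_map_eq_of_extConnLower_eq_zero h (hI.isInjMor i) Z x hx
      obtain rfl : y = 0 := hI.val_eq_zero (D := Z.unop) y
      exact map_zero (((T.Ext 1).flip.map j).app Z).hom
    have := NatIso.isIso_of_isIso_app (T.extConnLower ι)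
    exact ⟨asIso (T.extConnLower ι)⟩
  | succ n ih => exact ih.map extSuccIso

/-- Dimension shift along a coresolution by an injective object. -/
theorem nonempty_negII_equiv (h : T.Triangle i j ι) (hI : T.IsInjObj I) (n : ℕ) (Y : C) :
    Nonempty (T.NegII (n + 2) X Y ≃ₗ[R] T.NegII (n + 1) J Y) :=
  (nonempty_ext_iso h hI n).map fun e => Linear.homCongr R e.symm (Iso.refl _)

end Coresolution

end ExtriangulatedStructure

end Extri

namespace Extri

/-! ### Rank counts over a commutative ring that is a field -/

section Rank

variable {R : Type r} [CommRing R]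

theorem rank_eq_of_isField (hR : IsField R) {M : Type*} [AddCommGroup M] [Module R M]
    (S : Submodule R M) : Module.rank R M = Module.rank R (M ⧸ S) + Module.rank R S := by
  let _ := hR.toField
  exact (Submodule.rank_quotient_add_rank S).symm

theorem subsingleton_of_rank_eq_zero (hR : IsField R) {M : Type*} [AddCommGroup M] [Module R M]
    (h : Module.rank R M = 0) : Subsingleton M := by
  let _ := hR.toField
  exact rank_zero_iff.1 h

theorem rank_eq_zero_of_subsingleton (hR : IsField R) (M : Type*) [AddCommGroup M] [Module R M]
    [Subsingleton M] : Module.rank R M = 0 := by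
  let _ := hR.toField
  exact rank_zero_iff.2 inferInstance

theorem finite_of_injective_of_isField (hR : IsField R) {M N : Type*} [AddCommGroup M]
    [Module R M] [AddCommGroup N] [Module R N] [Module.Finite R N] (f : M →ₗ[R] N)
    (hf : Function.Injective f) : Module.Finite R M := by
  let _ := hR.toField
  exact Module.Finite.of_injective f hf

theorem rank_ker_eq_rank_ker (hR : IsField R) {M M' N N' : Type u} [AddCommGroup M]
    [Module R M] [AddCommGroup M'] [Module R M'] [AddCommGroup N] [Module R N]
    [AddCommGroup N'] [Module R N'] [Module.Finite R N] {f : M →ₗ[R] N} {f' : M' →ₗ[R] N'}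
    (hf : Function.Surjective f) (hf' : Function.Surjective f')
    (hM : Module.rank R M = Module.rank R M') (hN : Module.rank R N = Module.rank R N') :
    Module.rank R (LinearMap.ker f) = Module.rank R (LinearMap.ker f') := by
  let _ := hR.toField
  have h := rank_eq_of_isField hR (LinearMap.ker f)
  rw [hM, rank_eq_of_isField hR (LinearMap.ker f'),
    (f.quotKerEquivOfSurjective hf).rank_eq, (f'.quotKerEquivOfSurjective hf').rank_eq, ← hN] at h
  exact (Cardinal.eq_of_add_eq_add_left h (Module.rank_lt_aleph0 R N)).symm

/-- If the differentials to the middle terms vanish, isomorphic cohomologies and equal ranges of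
the last differentials yield equal ranks. -/
theorem rank_eq_of_cohomology_equiv (hR : IsField R) {L L' M M' : Type u} {N : Type w}
    [AddCommGroup L] [Module R L] [AddCommGroup L'] [Module R L'] [AddCommGroup M] [Module R M]
    [AddCommGroup M'] [Module R M'] [AddCommGroup N] [Module R N] {f : L →ₗ[R] M}
    {f' : L' →ₗ[R] M'} {g : M →ₗ[R] N} {g' : M' →ₗ[R] N} (hf : f = 0) (hf' : f' = 0)
    (e : Nonempty (Cohomology f g ≃ₗ[R] Cohomology f' g'))
    (hg : LinearMap.range g = LinearMap.range g') : Module.rank R M = Module.rank R M' := by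
  have key {L M : Type u} [AddCommGroup L] [Module R L] [AddCommGroup M] [Module R M]
      {f : L →ₗ[R] M} {g : M →ₗ[R] N} (hf : f = 0) :
      Module.rank R (Cohomology f g) = Module.rank R (LinearMap.ker g) := by
    refine (Submodule.quotEquivOfEqBot _ ?_).rank_eq
    rw [hf, LinearMap.range_zero]
    exact (LinearMap.ker g).ker_subtype
  obtain ⟨e⟩ := e
  rw [rank_eq_of_isField hR (LinearMap.ker g), rank_eq_of_isField hR (LinearMap.ker g'), ← key hf,
    ← key hf', e.rank_eq, (g.quotKerEquivRange.trans ((LinearEquiv.ofEq _ _ hg).trans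
      g'.quotKerEquivRange.symm)).rank_eq]

end Rank

namespace ExtriangulatedStructure

variable {R : Type r} [CommRing R] {C : Type u} [Category.{v} C] [Preadditive C] [Linear R C]
  [HasZeroObject C] [HasBinaryBiproducts C] {T : ExtriangulatedStructure.{r, u, v, w} R C}

theorem EnoughProjMor.exists_resolution (h : T.EnoughProjMor) (Y : C) :
    ∃ (Q P : C) (q : Q ⟶ P) (p : P ⟶ Y) (ω : Val T.E Y Q), T.Triangle q p ω ∧ T.IsProjMor p :=
  let ⟨P, p, ⟨Q, q, ω, hω⟩, hp⟩ := h Y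
  ⟨Q, P, q, p, ω, hω, hp⟩

theorem EnoughInjMor.exists_coresolution (h : T.EnoughInjMor) (X : C) :
    ∃ (I J : C) (i : X ⟶ I) (j : I ⟶ J) (ι : Val T.E J X), T.Triangle i j ι ∧ T.IsInjMor i :=
  let ⟨I, i, ⟨J, j, ι, hι⟩, hi⟩ := h X
  ⟨I, J, i, j, ι, hι, hi⟩

/-- `E_I^{-1}(X, Y)` embeds in `C(X, Q)`. Finiteness is what permits cancelling ranks in
`rank_ker_eq_rank_ker`. -/
theorem EnoughProjMor.finite_negI (h : T.EnoughProjMor) (hR : IsField R)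
    (hfin : ∀ X Y : C, Module.Finite R (X ⟶ Y)) (X Y : C) : Module.Finite R (T.NegI 1 X Y) := by
  obtain ⟨Q, P, q, p, ω, hω, hp⟩ := h.exists_resolution Y
  have := hfin X Q
  exact finite_of_injective_of_isField hR _ (hω.negIConn_injective hp X)

section Split

variable {Q P B : C} {q : Q ⟶ P} {v : P ⟶ Q} {a : P ⟶ B} {b : B ⟶ P}

/-- Pushing along `v` is a section: `v ≫ q` differs from the identity by `a ≫ b`, which acts as zero
since `E(a, -) = 0`. In `negIIPush_surjective` the same term vanishes by the assumption on `a`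
instead. -/
theorem negIPush_surjective (hv : v ≫ q + a ≫ b = 𝟙 P) (ha : T.IsProjMor a) (X : C) :
    Function.Surjective (T.negIPush 1 X q) := fun φ => by
  refine ⟨T.negIPush 1 X v φ, negI_ext fun Z ε => ?_⟩
  rw [negIConn_negIPush, negIConn_negIPush, ← pull_comp, eq_sub_of_add_eq hv, negIConn_pull_sub,
    pull_id, pull_comp, ha Z, LinearMap.zero_apply, negIConn_zero, sub_zero]

theorem negIIPush_surjective (hv : v ≫ q + a ≫ b = 𝟙 P) (X : C)
    (ha : T.negIIPush 1 X a = 0) : Function.Surjective (T.negIIPush 1 X q) := fun ψ => by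
  refine ⟨T.negIIPush 1 X v ψ, negII_ext fun Z ε => ?_⟩
  have h₁ : T.negIIConn ε P ψ ≫ a = 0 := by
    rw [← negIIConn_negIIPush, ha, LinearMap.zero_apply, map_zero]
  rw [negIIConn_negIIPush, negIIConn_negIIPush, Category.assoc, eq_sub_of_add_eq hv,
    Preadditive.comp_sub, Category.comp_id, ← Category.assoc, h₁, zero_comp, sub_zero]

end Split

section Cosplit

variable {I J B : C} {j : I ⟶ J} {v : J ⟶ I} {a : I ⟶ B} {b : B ⟶ I}

theorem negIIPull_surjective (hv : j ≫ v + a ≫ b = 𝟙 I) (hb : T.IsInjMor b) (Y : C) :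
    Function.Surjective (T.negIIPull 1 Y j) := fun ψ => by
  refine ⟨T.negIIPull 1 Y v ψ, negII_ext fun Z ε => ?_⟩
  rw [negIIConn_negIIPull, negIIConn_negIIPull, ← push_comp, eq_sub_of_add_eq hv,
    negIIConn_push_sub, push_id, push_comp, hb Z, LinearMap.zero_apply, negIIConn_zero, sub_zero]

theorem negIPull_surjective (hv : j ≫ v + a ≫ b = 𝟙 I) (Y : C)
    (hb : T.negIPull 1 Y b = 0) : Function.Surjective (T.negIPull 1 Y j) := fun φ => by
  refine ⟨T.negIPull 1 Y v φ, negI_ext fun Z ε => ?_⟩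
  have h₁ : b ≫ T.negIConn ε I φ = 0 := by
    rw [← negIConn_negIPull, hb, LinearMap.zero_apply, map_zero]
  rw [negIConn_negIPull, negIConn_negIPull, ← Category.assoc, eq_sub_of_add_eq hv,
    Preadditive.sub_comp, Category.id_comp, Category.assoc, h₁, comp_zero, sub_zero]

end Cosplit

/-! ### Equality of dimensions in degrees -1 and -2 -/

section Dimension

variable (hR : IsField R) (hP : T.EnoughProjMor) (hI : T.EnoughInjMor)
  (hi : ∀ {X I : C} (i : X ⟶ I), T.IsInflation i → T.IsInjMor i → ∀ Y : C, T.negIPull 1 Y i = 0)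
  (hp : ∀ {P Y : C} (p : P ⟶ Y), T.IsDeflation p → T.IsProjMor p →
    ∀ X : C, T.negIIPush 1 X p = 0)

include hR hP hI hi hp

theorem rank_negI_one_eq (X Y : C) :
    Module.rank R (T.NegI 1 X Y) = Module.rank R (T.NegII 1 X Y) := by
  obtain ⟨Q, P, q, p, ω, hω, hp'⟩ := hP.exists_resolution Y
  obtain ⟨I, J, i, j, ι, hι, hi'⟩ := hI.exists_coresolution X
  exact rank_eq_of_cohomology_equiv hR (hi i hι.isInflation hi' Y) (hp p hω.isDeflation hp' X)
    (nonempty_cohomology_lastI_equiv hι hω hi' hp') (range_lastI_eq_range_lastII hι hω hi' hp')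

theorem rank_negI_two_eq (hfin : ∀ X Y : C, Module.Finite R (X ⟶ Y)) (X Y : C) :
    Module.rank R (T.NegI 2 X Y) = Module.rank R (T.NegII 2 X Y) := by
  obtain ⟨Q, P, B, q, p, ω, v, a, b, hω, hp', ha, ha', hv⟩ := hP.exists_split_resolution Y
  obtain ⟨I, J, B', i, j, ι, v', a', b', hι, hi', hb, hb', hv'⟩ := hI.exists_split_coresolution X
  obtain ⟨e₁⟩ := nonempty_negI_equiv_ker hω hp' 0 X
  obtain ⟨e₂⟩ := nonempty_negII_equiv_ker hι hi' Y
  obtain ⟨e₃⟩ := nonempty_ker_negIPull_equiv hι hω hi' hp'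
  have := hP.finite_negI hR hfin X P
  have := hP.finite_negI hR hfin I Y
  -- The kernel of `q_*` on `E_I^{-1}` has the rank of the kernel of `q_*` on `E_II^{-1}`, which by
  -- (A) is that of `j^*` on `E_I^{-1}`, and finally that of `j^*` on `E_II^{-1}`.
  rw [e₁.rank_eq, e₂.rank_eq, rank_ker_eq_rank_ker hR (negIPush_surjective hv ha' X)
    (negIIPush_surjective hv X (hp a ha ha' X)) (rank_negI_one_eq hR hP hI hi hp _ _)
    (rank_negI_one_eq hR hP hI hi hp _ _), ← e₃.rank_eq]
  exact rank_ker_eq_rank_ker hR (negIPull_surjective hv' Y (hi b' hb hb' Y))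
    (negIIPull_surjective hv' hb' Y) (rank_negI_one_eq hR hP hI hi hp _ _)
    (rank_negI_one_eq hR hP hI hi hp _ _)

end Dimension

/-! ### Enough projective and injective objects -/

/-- An injective morphism factors through an inflation into an injective object `I₀`. The resulting
morphism `I₀ ⟶ Q` is killed by the inflation `q`, hence is zero by (NI). -/
theorem NI.negIPull_eq_zero (h : T.NI) (hP : T.EnoughProjMor) (hI : T.EnoughInjObj) {X I : C}
    (i : X ⟶ I) (hi : T.IsInjMor i) (Y : C) : T.negIPull 1 Y i = 0 := by
  obtain ⟨I₀, x, hI₀, hx⟩ := hI X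
  obtain ⟨g, rfl⟩ := hi.exists_extension hx
  obtain ⟨Q, P, q, p, ω, hω, hp⟩ := hP.exists_resolution Y
  ext1 φ
  refine hω.negIConn_injective hp X ?_
  have h₁ : g ≫ T.negIConn ω I φ = 0 := h I₀ hI₀ q hω.isInflation (by
    change (g ≫ T.negIConn ω I φ) ≫ q = 0 ≫ q
    rw [Category.assoc, hω.negIConn_comp, comp_zero, zero_comp])
  rw [negIConn_negIPull, Category.assoc, h₁, comp_zero, LinearMap.zero_apply, map_zero]

theorem NII.negIIPush_eq_zero (h : T.NII) (hP : T.EnoughProjObj) (hI : T.EnoughInjMor) {P Y : C}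
    (p : P ⟶ Y) (hp : T.IsProjMor p) (X : C) : T.negIIPush 1 X p = 0 := by
  obtain ⟨P₀, y, hP₀, hy⟩ := hP Y
  obtain ⟨g, rfl⟩ := hp.exists_lifting hy
  obtain ⟨I, J, i, j, ι, hι, hi⟩ := hI.exists_coresolution X
  ext1 ψ
  refine hι.negIIConn_injective hi Y ?_
  have h₁ : T.negIIConn ι P ψ ≫ g = 0 := h P₀ hP₀ j hι.isDeflation (by
    change j ≫ T.negIIConn ι P ψ ≫ g = j ≫ 0
    rw [← Category.assoc, hι.comp_negIIConn, comp_zero, zero_comp])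
  rw [negIIConn_negIIPush, ← Category.assoc, h₁, zero_comp, LinearMap.zero_apply, map_zero]

/-- Let `f : I ⟶ A` be killed by `x`. Resolving `B` by `F ⟶ P ⟶ B`, the dual of (ET4) gives a
resolution `Q ⟶ P ⟶ D` and a triangle `F ⟶ Q ⟶ A`. A lift of `f` to `Q`, corrected by a morphism
through `F`, is killed by `q`, so it defines an element of `E_I^{-1}(I, D) = 0`; thus the lift
factors through `F` and `f = 0`. -/
theorem NI_of_subsingleton_negI (hP : T.EnoughProjMor)
    (h : ∀ I Y : C, T.IsInjObj I → Subsingleton (T.NegI 1 I Y)) : T.NI := by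
  intro I hI A B x hx f f' hff'
  obtain ⟨D, y, δ, hδ⟩ := hx
  obtain ⟨F, P, m, a, ε, hε, ha⟩ := hP.exists_resolution B
  obtain ⟨Q, q, p, d, e, ω, rfl, hdq, heq, hω, hed, -⟩ := T.et4_op δ ε x y m a hδ hε
  rw [← sub_eq_zero]
  have hf : (f - f') ≫ x = 0 := by
    rw [Preadditive.sub_comp, sub_eq_zero]
    exact hff'
  obtain ⟨g, hg⟩ := Triangle.exists_lifting (T := T) hed (f - f') (by
    rw [← pull_comp, hf, T.pull_zero])
  obtain ⟨k, hk⟩ := hε.exists_lift (g ≫ q) (by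
    rw [Category.assoc, ← hdq, ← Category.assoc, hg, hf])
  have hed₀ : e ≫ d = 0 := Triangle.comp_eq_zero (T := T) hed
  obtain ⟨φ, hφ⟩ := Triangle.exists_negIConn_eq (T := T) hω (ha.comp y) (g - k ≫ e) (by
    rw [Preadditive.sub_comp, Category.assoc, heq, hk, sub_self])
  have := h I D hI
  rw [Subsingleton.elim φ 0, map_zero] at hφ
  rw [← hg, sub_eq_zero.1 hφ.symm, Category.assoc, hed₀, comp_zero]

theorem NII_of_subsingleton_negII (hI : T.EnoughInjMor)
    (h : ∀ X P : C, T.IsProjObj P → Subsingleton (T.NegII 1 X P)) : T.NII := by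
  intro P hP B D y hy f f' hff'
  obtain ⟨A, x, δ, hδ⟩ := hy
  obtain ⟨I, F, b, m, ε, hε, hb⟩ := hI.exists_coresolution B
  obtain ⟨J, i, j, d, e, ι, rfl, hdj, hje, hι, hde, -⟩ := T.et4 δ ε x y b m hδ hε
  rw [← sub_eq_zero]
  have hf : y ≫ (f - f') = 0 := by
    rw [Preadditive.comp_sub, sub_eq_zero]
    exact hff'
  obtain ⟨g, hg⟩ := Triangle.exists_extension (T := T) hde (f - f') (by
    rw [← push_comp, hf, T.push_zero])
  obtain ⟨k, hk⟩ := hε.exists_desc (j ≫ g) (by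
    rw [← Category.assoc, ← hdj, Category.assoc, hg, hf])
  have hde₀ : d ≫ e = 0 := Triangle.comp_eq_zero (T := T) hde
  obtain ⟨ψ, hψ⟩ := Triangle.exists_negIIConn_eq (T := T) hι (hb.comp' x) (g - e ≫ k) (by
    rw [Preadditive.comp_sub, ← Category.assoc, hje, hk, sub_self])
  have := h A P hP
  rw [Subsingleton.elim ψ 0, map_zero] at hψ
  rw [← hg, sub_eq_zero.1 hψ.symm, ← Category.assoc, hde₀, zero_comp]

theorem rank_negI_eq_of_one_of_two (hP : T.EnoughProjObj) (hI : T.EnoughInjObj)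
    (h₁ : ∀ X Y : C, Module.rank R (T.NegI 1 X Y) = Module.rank R (T.NegII 1 X Y))
    (h₂ : ∀ X Y : C, Module.rank R (T.NegI 2 X Y) = Module.rank R (T.NegII 2 X Y)) (n : ℕ) :
    ∀ X Y : C, Module.rank R (T.NegI (n + 1) X Y) = Module.rank R (T.NegII (n + 1) X Y) := by
  -- Moving a syzygy of the second variable to a cosyzygy of the first preserves the rank of `E_II`.
  -- In degree -1 both sides have the rank of degree -2 at `(X, Y)`; higher degrees reduce to this
  -- by replacing `X` with its cosyzygy.
  have shift {X I J Q P Y : C} {i : X ⟶ I} {j : I ⟶ J} {ι : Val T.E J X} {q : Q ⟶ P}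
      {p : P ⟶ Y} {ω : Val T.E Y Q} (hι : T.Triangle i j ι) (hω : T.Triangle q p ω)
      (hI' : T.IsInjObj I) (hP' : T.IsProjObj P) (n : ℕ) :
      Module.rank R (T.NegII (n + 1) X Q) = Module.rank R (T.NegII (n + 1) J Y) := by
    induction n generalizing X I J with
    | zero =>
      obtain ⟨e₁⟩ := nonempty_negI_equiv hω hP' 0 X
      obtain ⟨e₂⟩ := nonempty_negII_equiv hι hI' 0 Y
      rw [← e₂.rank_eq, ← h₂, e₁.rank_eq, h₁]
    | succ n ih =>
      obtain ⟨I', i', hI'', J', j', ι', hι'⟩ := hI J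
      obtain ⟨e₁⟩ := nonempty_negII_equiv hι hI' n Q
      obtain ⟨e₂⟩ := nonempty_negII_equiv hι' hI'' n Y
      rw [e₁.rank_eq, e₂.rank_eq]
      exact ih hι' hI''
  induction n with
  | zero => exact h₁
  | succ n ih =>
    intro X Y
    obtain ⟨I, i, hI', J, j, ι, hι⟩ := hI X
    obtain ⟨P, p, hP', Q, q, ω, hω⟩ := hP Y
    obtain ⟨e₁⟩ := nonempty_negI_equiv hω hP' n X
    obtain ⟨e₂⟩ := nonempty_negII_equiv hι hI' n Y
    rw [e₁.rank_eq, e₂.rank_eq, ih, shift hι hω hI' hP']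

end ExtriangulatedStructure

end Extri

open Extri ExtriangulatedStructure in
theorem mainTheorem10 {R : Type r} [CommRing R] {C : Type u} [Category.{v} C] [Preadditive C]
    [Linear R C] [HasZeroObject C] [HasBinaryBiproducts C]
    (T : Extri.ExtriangulatedStructure.{r, u, v, w} R C) :
    -- comparison of the two four-term complexes
    (T.EnoughProjMor → T.EnoughInjMor →
      ∀ {X I J Q P Y : C} (i : X ⟶ I) (j : I ⟶ J) (ι : Extri.Val T.E J X)
        (q : Q ⟶ P) (p : P ⟶ Y) (ω : Extri.Val T.E Y Q),
        T.Triangle i j ι → T.Triangle q p ω → T.IsInjMor i → T.IsProjMor p →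
        (T.negIPull 1 Y i ∘ₗ T.negIPull 1 Y j = 0 ∧ T.lastI ι ω ∘ₗ T.negIPull 1 Y i = 0) ∧
        (T.negIIPush 1 X p ∘ₗ T.negIIPush 1 X q = 0 ∧ T.lastII ι ω ∘ₗ T.negIIPush 1 X p = 0) ∧
        Nonempty (LinearMap.ker (T.negIPull 1 Y j) ≃ₗ[R] LinearMap.ker (T.negIIPush 1 X q)) ∧
        Nonempty (Extri.Cohomology (T.negIPull 1 Y j) (T.negIPull 1 Y i) ≃ₗ[R]
          Extri.Cohomology (T.negIIPush 1 X q) (T.negIIPush 1 X p)) ∧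
        Nonempty (Extri.Cohomology (T.negIPull 1 Y i) (T.lastI ι ω) ≃ₗ[R]
          Extri.Cohomology (T.negIIPush 1 X p) (T.lastII ι ω)) ∧
        Nonempty ((Extri.Val T.E J Q ⧸ LinearMap.range (T.lastI ι ω)) ≃ₗ[R]
          (Extri.Val T.E J Q ⧸ LinearMap.range (T.lastII ι ω)))) ∧
    -- equality of dimensions in degrees -1 and -2
    (IsField R → (∀ X Y : C, Module.Finite R (X ⟶ Y)) → T.EnoughProjMor → T.EnoughInjMor →
      (∀ {X I : C} (i : X ⟶ I), T.IsInflation i → T.IsInjMor i →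
        ∀ Y : C, T.negIPull 1 Y i = 0) →
      (∀ {P Y : C} (p : P ⟶ Y), T.IsDeflation p → T.IsProjMor p →
        ∀ X : C, T.negIIPush 1 X p = 0) →
      ∀ X Y : C,
        Module.rank R (T.NegI 1 X Y) = Module.rank R (T.NegII 1 X Y) ∧
        Module.rank R (T.NegI 2 X Y) = Module.rank R (T.NegII 2 X Y)) ∧
    -- the equivalence
    (IsField R → (∀ X Y : C, Module.Finite R (X ⟶ Y)) → T.EnoughProjObj → T.EnoughInjObj →
      List.TFAE [
        T.NI ∧ T.NII,
        ∀ X Y : C, Module.rank R (T.NegI 1 X Y) = Module.rank R (T.NegII 1 X Y),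
        ∀ X Y : C, ∀ n : ℕ, 0 < n →
          Module.rank R (T.NegI n X Y) = Module.rank R (T.NegII n X Y)]) := by
  refine ⟨fun hP hI X I J Q P Y i j ι q p ω hι hω hi hp => ?_,
    fun hR hfin hP hI hi hp X Y => ⟨rank_negI_one_eq hR hP hI hi hp X Y,
      rank_negI_two_eq hR hP hI hi hp hfin X Y⟩, fun hR hfin hP hI => ?_⟩
  · exact ⟨⟨hι.negIPull_comp Y, hι.lastI_comp ω⟩, ⟨hω.negIIPush_comp X, hω.lastII_comp ι⟩,
      nonempty_ker_negIPull_equiv hι hω hi hp, nonempty_cohomology_negIPull_equiv hι hω hi hp,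
      nonempty_cohomology_lastI_equiv hι hω hi hp,
      ⟨Submodule.quotEquivOfEq _ _ (range_lastI_eq_range_lastII hι hω hi hp)⟩⟩
  · have hP' := hP.enoughProjMor
    have hI' := hI.enoughInjMor
    tfae_have 1 → 3 := by
      rintro ⟨h, h'⟩ X Y n hn
      have hi : ∀ {X I : C} (i : X ⟶ I), T.IsInflation i → T.IsInjMor i → ∀ Y : C,
          T.negIPull 1 Y i = 0 := fun i _ hi => h.negIPull_eq_zero hP' hI i hi
      have hp : ∀ {P Y : C} (p : P ⟶ Y), T.IsDeflation p → T.IsProjMor p → ∀ X : C,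
          T.negIIPush 1 X p = 0 := fun p _ hp => h'.negIIPush_eq_zero hP hI' p hp
      obtain ⟨n, rfl⟩ := Nat.exists_eq_add_of_lt hn
      rw [zero_add]
      exact rank_negI_eq_of_one_of_two hP hI (rank_negI_one_eq hR hP' hI' hi hp)
        (rank_negI_two_eq hR hP' hI' hi hp hfin) n X Y
    tfae_have 3 → 2 := fun h X Y => h X Y 1 one_pos
    tfae_have 2 → 1 := fun h => by
      refine ⟨NI_of_subsingleton_negI hP' fun I Y hI => ?_,
        NII_of_subsingleton_negII hI' fun X P hP => ?_⟩
      -- For injective `I`, `E_II^{-1}(I, Y)` vanishes because `E(-, I) = 0`, so equality of ranks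
      -- kills `E_I^{-1}(I, Y)`.
      · have := hI.subsingleton_negII Y
        exact subsingleton_of_rank_eq_zero hR ((h I Y).trans (rank_eq_zero_of_subsingleton hR _))
      · have := hP.subsingleton_negI 0 X
        exact subsingleton_of_rank_eq_zero hR
          ((h X P).symm.trans (rank_eq_zero_of_subsingleton hR _))
    tfae_finish
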